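/- Let $K$ be an algebraically closed field and let $Q$ be a finite connected quiver. Paths in $Q$ are composed from left to right, so for arrows $\alpha:i\to j$ and $\beta:j\to k$ the path $\alpha\beta$ goes from $i$ to $k$. Let $R$ be the ideal of the path algebra $KQ$ generated by the arrows, and let $I$ be an admissible ideal of $KQ$, that is, a two-sided ideal with $R^m\subseteq I\subseteq R^2$ for some $m\geq 2$. Put $\Lambda=KQ/I$. Assume that (a) $\Lambda$ is symmetric, that is, there is a nondegenerate symmetric $K$-bilinear form $(-,-):\Lambda\times\Lambda\to K$ with $(ab,c)=(a,bc)$ for all $a,b,c\in\Lambda$; and (b) $\Lambda$ is a periodic algebra of period $4$, that is, $d=4$ is the smallest integer $d\geq 1$ such that $\Omega^d(\Lambda)\cong\Lambda$ as $\Lambda$-bimodules, where $\Omega$ denotes the syzygy (the kernel of a projective cover) of modules over the enveloping algebra $\Lambda\otimes_K\Lambda^{\mathrm{op}}$. A minimal relation of $I$ is an element of $I$ that does not lie in $RI+IR$. For a path $p$ in $Q$ write $p\prec I$ if $p$ occurs with nonzero coefficient in some minimal relation of $I$. Let $\alpha:i\to j$ and $\beta:j\to k$ be arrows of $Q$ with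 $\alpha\beta\prec I$. Then $Q$ has an arrow $k\to i$, so that $\alpha$ and $\beta$ are part of a triangle $i\to j\to k\to i$ in $Q$ (where the vertices $i,j,k$ need not be distinct). No assumption on the representation type of $\Lambda$ (tame or wild), and no bound on the number of arrows starting or ending at a vertex of $Q$, is needed. -/

import Mathlib

open scoped TensorProduct

universe u v w

noncomputable section

/-- All paths of a quiver, including the trivial path `e_a` at each vertex `a`. -/
abbrev QuiverPath (V : Type v) [Quiver.{w} V] : Type (max v w) :=
  Σ a b : V, Quiver.Path a b

/-- The path algebra `K Q`: formal linear combinations of paths. Paths are composed from left to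
right, so that for arrows `α : i ⟶ j` and `β : j ⟶ k` the product `α β` is the path
"first `α`, then `β`". -/
def PathAlgebra (K : Type u) (V : Type v) [Field K] [Quiver.{w} V] : Type (max u v w) :=
  QuiverPath V →₀ K

namespace PathAlgebra

section Basic

variable (K : Type u) {V : Type v} [Field K] [Quiver.{w} V]

instance : AddCommGroup (PathAlgebra K V) := inferInstanceAs (AddCommGroup (QuiverPath V →₀ K))

instance : Module K (PathAlgebra K V) := inferInstanceAs (Module K (QuiverPath V →₀ K))

/-- A path, as an element of the path algebra. -/
def ofPath {a b : V} (p : Quiver.Path a b) : PathAlgebra K V :=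
  Finsupp.single (⟨a, b, p⟩ : QuiverPath V) (1 : K)

/-- The coefficient of a path in an element of the path algebra. -/
def coeff {K : Type u} [Field K] (x : PathAlgebra K V) {a b : V} (p : Quiver.Path a b) : K :=
  (show QuiverPath V →₀ K from x) ⟨a, b, p⟩

open Classical in
/-- The product of two paths: their composition if the first ends where the second starts, and
zero otherwise. -/
def pathMul (p q : QuiverPath V) : PathAlgebra K V :=
  if h : p.2.1 = q.1 then ofPath K (p.2.2.comp (q.2.2.cast h.symm rfl)) else 0

/-- The multiplication of the path algebra, as the bilinear extension of `pathMul`. -/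
def mulHom : PathAlgebra K V →ₗ[K] PathAlgebra K V →ₗ[K] PathAlgebra K V :=
  Finsupp.linearCombination K fun p : QuiverPath V =>
    (Finsupp.linearCombination K fun q : QuiverPath V => pathMul K p q :
      (QuiverPath V →₀ K) →ₗ[K] PathAlgebra K V)

instance : Mul (PathAlgebra K V) := ⟨fun x y => mulHom K x y⟩

theorem mulHom_ofPath {a b c d : V} (p : Quiver.Path a b) (q : Quiver.Path c d) :
    mulHom K (ofPath K p) (ofPath K q) = pathMul K ⟨a, b, p⟩ ⟨c, d, q⟩ := by
  unfold mulHom ofPath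
  erw [Finsupp.linearCombination_single, one_smul, Finsupp.linearCombination_single, one_smul]

theorem pathMul_comp {a b c : V} (p : Quiver.Path a b) (q : Quiver.Path b c) :
    pathMul K ⟨a, b, p⟩ ⟨b, c, q⟩ = ofPath K (p.comp q) := by
  simp [pathMul]

theorem pathMul_of_ne {a b c d : V} (p : Quiver.Path a b) (q : Quiver.Path c d) (h : b ≠ c) :
    pathMul K ⟨a, b, p⟩ ⟨c, d, q⟩ = 0 := by
  simp [pathMul, h]

variable {K} in
/-- Induction on elements of the path algebra: they are sums of scalar multiples of paths. -/
theorem induction_on {P : PathAlgebra K V → Prop} (x : PathAlgebra K V) (zero : P 0)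
    (add : ∀ y z, P y → P z → P (y + z))
    (smul_path : ∀ (c : K) (a b : V) (p : Quiver.Path a b), P (c • ofPath K p)) : P x := by
  refine Finsupp.induction_linear (motive := P) x zero add ?_
  rintro ⟨a, b, p⟩ c
  have h := smul_path c a b p
  have e : c • ofPath K p = (Finsupp.single (⟨a, b, p⟩ : QuiverPath V) c : PathAlgebra K V) := by
    unfold ofPath
    erw [Finsupp.smul_single, smul_eq_mul, mul_one]
  rwa [e] at h

theorem mulHom_assoc (x y z : PathAlgebra K V) :
    mulHom K (mulHom K x y) z = mulHom K x (mulHom K y z) := by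
  induction x using induction_on with
  | zero => simp
  | add x₁ x₂ h₁ h₂ => simp [h₁, h₂]
  | smul_path r a b p =>
    induction y using induction_on with
    | zero => simp
    | add y₁ y₂ h₁ h₂ => simp only [map_add, LinearMap.add_apply, h₁, h₂]
    | smul_path s c d q =>
      induction z using induction_on with
      | zero => simp
      | add z₁ z₂ h₁ h₂ => simp only [map_add, h₁, h₂]
      | smul_path t e f l =>
        simp only [map_smul, LinearMap.smul_apply, mulHom_ofPath]
        congr 3
        by_cases hbc : b = c
        · subst hbc
          by_cases hde : d = e
          · subst hde
            simp [pathMul_comp, mulHom_ofPath, Quiver.Path.comp_assoc]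
          · simp [pathMul_comp, mulHom_ofPath, pathMul_of_ne _ _ _ hde]
        · by_cases hde : d = e
          · subst hde
            simp [pathMul_comp, mulHom_ofPath, pathMul_of_ne _ _ _ hbc]
          · simp [pathMul_of_ne _ _ _ hbc, pathMul_of_ne _ _ _ hde]

end Basic

section Algebra

variable (K : Type u) {V : Type v} [Field K] [Quiver.{w} V] [Fintype V]

/-- The unit of the path algebra of a quiver with finitely many vertices is the sum of all
trivial paths. -/
instance : One (PathAlgebra K V) := ⟨∑ a : V, ofPath K (Quiver.Path.nil : Quiver.Path a a)⟩

theorem mulHom_one_left (x : PathAlgebra K V) : mulHom K 1 x = x := by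
  change mulHom K (∑ a : V, ofPath K (Quiver.Path.nil : Quiver.Path a a)) x = x
  induction x using induction_on with
  | zero => simp
  | add x₁ x₂ h₁ h₂ => simp only [map_add, h₁, h₂]
  | smul_path r a b p =>
    simp only [map_smul, map_sum, LinearMap.sum_apply, mulHom_ofPath]
    rw [Finset.sum_eq_single a, pathMul_comp, Quiver.Path.nil_comp]
    · exact fun c _ hc => pathMul_of_ne K _ _ hc
    · simp

theorem mulHom_one_right (x : PathAlgebra K V) : mulHom K x 1 = x := by
  change mulHom K x (∑ a : V, ofPath K (Quiver.Path.nil : Quiver.Path a a)) = x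
  induction x using induction_on with
  | zero => simp
  | add x₁ x₂ h₁ h₂ => simp only [map_add, LinearMap.add_apply, h₁, h₂]
  | smul_path r a b p =>
    rw [map_smul, LinearMap.smul_apply, map_sum]
    simp only [mulHom_ofPath]
    rw [Finset.sum_eq_single b, pathMul_comp, Quiver.Path.comp_nil]
    · exact fun c _ hc => pathMul_of_ne K _ _ hc.symm
    · simp

instance : Ring (PathAlgebra K V) :=
  { (inferInstance : AddCommGroup (PathAlgebra K V)),
    (inferInstance : Mul (PathAlgebra K V)),
    (inferInstance : One (PathAlgebra K V)) with
    left_distrib := fun x y z => map_add (mulHom K x) y z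
    right_distrib := fun x y z => LinearMap.map_add₂ (mulHom K) x y z
    zero_mul := fun x => LinearMap.map_zero₂ (mulHom K) x
    mul_zero := fun x => map_zero (mulHom K x)
    mul_assoc := mulHom_assoc K
    one_mul := mulHom_one_left K
    mul_one := mulHom_one_right K }

instance : Algebra K (PathAlgebra K V) :=
  Algebra.ofModule (fun r x y => LinearMap.map_smul₂ (mulHom K) r x y)
    (fun r x y => map_smul (mulHom K x) r y)

variable (V) in
/-- The arrow ideal of the path algebra: the two-sided ideal generated by all arrows. -/
def arrowIdeal : Ideal (PathAlgebra K V) :=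
  (TwoSidedIdeal.span
    {x : PathAlgebra K V | ∃ (a b : V) (α : a ⟶ b), x = ofPath K α.toPath}).asIdeal

variable {K}

/-- A two-sided ideal `I` of `K Q` is admissible if `R ^ m ⊆ I ⊆ R ^ 2` for some `m ≥ 2`, where
`R` is the arrow ideal. -/
def IsAdmissible (I : Ideal (PathAlgebra K V)) : Prop :=
  I.IsTwoSided ∧ I ≤ arrowIdeal K V ^ 2 ∧ ∃ m : ℕ, 2 ≤ m ∧ arrowIdeal K V ^ m ≤ I

/-- A minimal relation of `I`, i.e. a minimal generator of the two-sided ideal `I`: an element of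
`I` whose class in `I / (R I + I R)` is nonzero, where `R` is the arrow ideal. -/
def IsMinimalRelation (I : Ideal (PathAlgebra K V)) (ρ : PathAlgebra K V) : Prop :=
  ρ ∈ I ∧ ρ ∉ arrowIdeal K V * I ⊔ I * arrowIdeal K V

/-- The relation `p ≺ I`: the path `p` occurs, with nonzero coefficient, as a term of some
minimal relation of `I`. -/
def OccursInMinimalRelation (I : Ideal (PathAlgebra K V)) {a b : V} (p : Quiver.Path a b) :
    Prop :=
  ∃ ρ : PathAlgebra K V, IsMinimalRelation I ρ ∧ ρ.coeff p ≠ 0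

end Algebra

end PathAlgebra

/-- A quiver is connected if it is nonempty and its underlying undirected graph is connected. -/
def IsConnectedQuiver (V : Type v) [Quiver.{w} V] : Prop :=
  Nonempty V ∧ Subsingleton (Quiver.WeaklyConnectedComponent V)

/-- A `K`-algebra is symmetric if it carries a nondegenerate symmetric bilinear form which is
associative. -/
def IsSymmetricFDAlgebra (K : Type u) (A : Type v) [Field K] [Ring A] [Algebra K A] : Prop :=
  ∃ B : LinearMap.BilinForm K A, B.Nondegenerate ∧ (∀ a b : A, B a b = B b a) ∧
    ∀ a b c : A, B (a * b) c = B a (b * c)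

section Syzygy

variable (R : Type u) [Ring R]

/-- A submodule `N` of `P` is superfluous if `N + L = P` forces `L = P`. -/
def IsSuperfluous {P : Type v} [AddCommGroup P] [Module R P] (N : Submodule R P) : Prop :=
  ∀ L : Submodule R P, N ⊔ L = ⊤ → L = ⊤

/-- A projective cover of `M`: a surjection from a projective module with superfluous kernel. -/
def IsProjectiveCover {P M : Type v} [AddCommGroup P] [Module R P] [AddCommGroup M] [Module R M]
    (π : P →ₗ[R] M) : Prop :=
  Module.Projective R P ∧ Function.Surjective π ∧ IsSuperfluous R (LinearMap.ker π)

/-- `N` is isomorphic to the syzygy `Ω M`, the kernel of a projective cover of `M`. -/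
def IsSyzygy (M N : Type v) [AddCommGroup M] [Module R M] [AddCommGroup N] [Module R N] : Prop :=
  ∃ (P : Type v) (_ : AddCommGroup P) (_ : Module R P) (π : P →ₗ[R] M),
    IsProjectiveCover R π ∧ Nonempty (N ≃ₗ[R] LinearMap.ker π)

/-- `N` is isomorphic to the `n`-th syzygy `Ω ^ n M`. -/
def IsIteratedSyzygy : ℕ → ∀ (M N : Type v) [AddCommGroup M] [Module R M] [AddCommGroup N]
    [Module R N], Prop
  | 0, M, N, _, _, _, _ => Nonempty (M ≃ₗ[R] N)
  | n + 1, M, N, _, _, _, _ => ∃ (L : Type v) (_ : AddCommGroup L) (_ : Module R L),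
      IsSyzygy R M L ∧ IsIteratedSyzygy n L N

/-- `M` is a periodic module of period `d`: `d` is the smallest positive integer such that
`Ω ^ d M` is isomorphic to `M`. -/
def HasPeriod (M : Type v) [AddCommGroup M] [Module R M] (d : ℕ) : Prop :=
  1 ≤ d ∧ IsIteratedSyzygy R d M M ∧ ∀ e : ℕ, 1 ≤ e → e < d → ¬ IsIteratedSyzygy R e M M

end Syzygy

/-- `A` is a periodic algebra of period `d`: it has period `d` as a bimodule over itself, i.e. as
a module over its enveloping algebra, where `a ⊗ b` acts by `x ↦ a * x * b`. -/
def IsPeriodicAlgebra (K : Type u) (A : Type v) [Field K] [Ring A] [Algebra K A] (d : ℕ) : Prop :=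
  letI : Module (A ⊗[K] Aᵐᵒᵖ) A := TensorProduct.Algebra.module
  HasPeriod (A ⊗[K] Aᵐᵒᵖ) A d

end

/-! Let `S_l` be the simple left module at the vertex `l`. A relation from `i` to `k` involving `αβ`
gives a nonzero class in `Ext²(S_k, S_i)`. Over a symmetric algebra Auslander–Reiten duality
identifies this space with the dual of `Ext¹(S_i, Ω⁴ S_k)`, and period 4 turns that into the dual of
`Ext¹(S_i, S_k)`, which is spanned by the arrows `k ⟶ i`.

The proof carries out this duality by hand on an exact bimodule sequence `0 → Λ → P₃ → P₂ → P₁ → P₀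
→ Λ → 0`. The Ext² class becomes a form `Θ` on `P₂`, semilinear along a character of the enveloping
algebra and zero on boundaries. A relation `ρ` yields a cycle in `P₁`, hence some `p` in `P₂` with
`Θ p` the coefficient of `αβ` in `ρ` (`exists_extension`, `exists_chain`). The socle element of the
character kills `d₂ p`. If no arrow `k ⟶ i` exists, `cocycle_apply_eq_zero` forces `Θ p = 0`: the
obstruction lies in `Ext¹(S_i, S_k)`, which vanishes by `exists_eq_mul_quotientCharacter`. -/

open MulOpposite

noncomputable section

/-! ### Symmetrizing forms and socle elements of characters. -/

/-- A linear form on an algebra whose associated bilinear form `(a, b) ↦ t (a * b)` is symmetric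
and nondegenerate. -/
structure IsSymmetrizingForm {K A : Type*} [Field K] [Ring A] [Algebra K A] (t : A →ₗ[K] K) :
    Prop where
  comm : ∀ a b, t (a * b) = t (b * a)
  eq_zero : ∀ a, (∀ b, t (b * a) = 0) → a = 0

theorem IsSymmetricFDAlgebra.exists_isSymmetrizingForm {K A : Type*} [Field K] [Ring A]
    [Algebra K A] (h : IsSymmetricFDAlgebra K A) : ∃ t : A →ₗ[K] K, IsSymmetrizingForm t := by
  obtain ⟨B, hB, hs, ha⟩ := h
  have key : ∀ a b, LinearMap.flip B 1 (a * b) = B a b := fun a b => by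
    rw [LinearMap.flip_apply, ha, mul_one]
  refine ⟨LinearMap.flip B 1, fun a b => by rw [key, key, hs], fun a h => hB.2 a fun b => ?_⟩
  rw [← key, h]

namespace IsSymmetrizingForm

section Algebra

variable {K A : Type*} [Field K] [Ring A] [Algebra K A] {t : A →ₗ[K] K}

theorem ext (ht : IsSymmetrizingForm t) {a a' : A} (h : ∀ b, t (b * a) = t (b * a')) : a = a' :=
  sub_eq_zero.1 <| ht.eq_zero _ fun b => by rw [mul_sub, map_sub, h, sub_self]

/-- Over a finite-dimensional algebra, every linear form is represented by an element. -/
theorem exists_dual [FiniteDimensional K A] (ht : IsSymmetrizingForm t) (f : A →ₗ[K] K) :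
    ∃ s : A, ∀ v, t (v * s) = f v := by
  let F : A →ₗ[K] Module.Dual K A :=
    LinearMap.mk₂ K (fun s v => t (v * s)) (by simp [mul_add]) (by simp) (by simp [add_mul])
      (by simp)
  have hF : Function.Injective F := (injective_iff_map_eq_zero F).2 fun a h =>
    ht.eq_zero a fun b => LinearMap.congr_fun h b
  obtain ⟨s, hs⟩ := (LinearMap.injective_iff_surjective_of_finrank_eq_finrank
    (Subspace.dual_finrank_eq (K := K) (V := A)).symm).1 hF f
  exact ⟨s, fun v => LinearMap.congr_fun hs v⟩

variable {χ : A →ₐ[K] K} {s : A}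

/-- The element `s` representing `χ` under `t` spans a one-dimensional socle piece. Symmetry of `t`
makes the left and right actions on it agree, and nondegeneracy makes every other eigenvector of `χ`
a multiple of it. -/
theorem mul_dual (ht : IsSymmetrizingForm t) (hs : ∀ v, t (v * s) = χ v) (u : A) :
    u * s = χ u • s :=
  ht.ext fun v => by rw [← mul_assoc, hs, map_mul, mul_smul_comm, map_smul, hs, smul_eq_mul,
    mul_comm]

theorem dual_mul (ht : IsSymmetrizingForm t) (hs : ∀ v, t (v * s) = χ v) (u : A) :
    s * u = χ u • s :=
  ht.ext fun v => by rw [← mul_assoc, ht.comm, ← mul_assoc, hs, map_mul, mul_smul_comm, map_smul,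
    hs, smul_eq_mul]

theorem apply_dual (hs : ∀ v, t (v * s) = χ v) : t s = 1 := by simpa using hs 1

theorem dual_ne_zero (hs : ∀ v, t (v * s) = χ v) : s ≠ 0 := fun h => by
  simpa [h] using apply_dual hs

theorem eq_smul_dual (ht : IsSymmetrizingForm t) (hs : ∀ v, t (v * s) = χ v) {a : A}
    (ha : ∀ u, u * a = χ u • a) : a = t a • s :=
  ht.ext fun v => by rw [ha, mul_smul_comm, map_smul, map_smul, hs, smul_eq_mul, smul_eq_mul,
    mul_comm]

theorem eq_smul_dual' (ht : IsSymmetrizingForm t) (hs : ∀ v, t (v * s) = χ v) {a : A}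
    (ha : ∀ u, a * u = χ u • a) : a = t a • s :=
  ht.ext fun v => by rw [ht.comm, ha, mul_smul_comm, map_smul, map_smul, hs, smul_eq_mul,
    smul_eq_mul, mul_comm]

/-- A semilinear form on a projective module is zero on the elements killed by the socle element
of its character. -/
theorem apply_eq_zero_of_dual_smul (ht : IsSymmetrizingForm t) (hs : ∀ v, t (v * s) = χ v)
    {P : Type*} [AddCommGroup P] [Module A P]
    [Module.Projective A P] (Θ : P →ₛₗ[(χ : A →+* K)] K) {p : P} (hp : s • p = 0) : Θ p = 0 := by
  obtain ⟨f, hf⟩ := Module.projective_def'.1 ‹_›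
  -- In coordinates of a free module containing `P`, `s • p = 0` reads `χ (f p x) • s = 0`, so all
  -- the scalars appearing in `Θ p` vanish.
  have h0 : ∀ x, χ (f p x) = 0 := fun x => by
    have : s * f p x = 0 := by
      have := DFunLike.congr_fun (f.map_smul s p) x
      rw [hp, map_zero] at this
      simpa using this.symm
    rw [ht.dual_mul hs] at this
    exact (smul_eq_zero.1 this).resolve_right (dual_ne_zero hs)
  rw [← LinearMap.id_apply (R := A) p, ← hf, LinearMap.comp_apply, Finsupp.linearCombination_apply,
    Finsupp.sum, map_sum]
  refine Finset.sum_eq_zero fun x _ => ?_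
  rw [map_smulₛₗ]
  simp [h0]

/-- In a projective module the elements on which the algebra acts through a character are the
multiples of the corresponding socle element. -/
theorem exists_eq_dual_smul (ht : IsSymmetrizingForm t) (hs : ∀ v, t (v * s) = χ v)
    {P : Type*} [AddCommGroup P] [Module A P]
    [Module.Projective A P] {y : P} (hy : ∀ u : A, u • y = algebraMap K A (χ u) • y) :
    ∃ w : P, y = s • w := by
  obtain ⟨f, hf⟩ := Module.projective_def'.1 ‹_›
  have h0 : ∀ x, f y x = s * algebraMap K A (t (f y x)) := fun x => by
    rw [← Algebra.commutes, ← Algebra.smul_def]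
    refine ht.eq_smul_dual hs fun u => ?_
    have := DFunLike.congr_fun (congrArg f (hy u)) x
    rw [map_smul, map_smul] at this
    simpa [Algebra.smul_def] using this
  -- Each coordinate of `y` is its `t`-value times `s`; `w` collects these `t`-values.
  refine ⟨(f y).sum fun x a => algebraMap K A (t a) • x, ?_⟩
  conv_lhs => rw [← LinearMap.id_apply (R := A) y, ← hf, LinearMap.comp_apply,
    Finsupp.linearCombination_apply]
  rw [Finsupp.sum, Finsupp.sum, Finset.smul_sum]
  refine Finset.sum_congr rfl fun x _ => ?_
  rw [smul_smul, ← h0, id]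

end Algebra

/-! ### The enveloping algebra: symmetrizing form and characters. -/

section Enveloping

variable {K A : Type*} [Field K] [Ring A] [Algebra K A] {t : A →ₗ[K] K}

/-- The linear form `a ⊗ b ↦ t a * t b` on the enveloping algebra. -/
def enveloping (t : A →ₗ[K] K) : A ⊗[K] Aᵐᵒᵖ →ₗ[K] K :=
  LinearMap.mul' K K ∘ₗ TensorProduct.map t (t ∘ₗ (opLinearEquiv K).symm.toLinearMap)

@[simp]
theorem enveloping_tmul (a : A) (b : Aᵐᵒᵖ) : enveloping t (a ⊗ₜ b) = t a * t b.unop := by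
  simp [enveloping]

theorem isSymmetrizingForm_enveloping [FiniteDimensional K A] (ht : IsSymmetrizingForm t) :
    IsSymmetrizingForm (enveloping t) where
  comm x y := by
    induction x with
    | zero => simp
    | add x₁ x₂ h₁ h₂ => simp only [add_mul, mul_add, map_add, h₁, h₂]
    | tmul a b =>
      induction y with
      | zero => simp
      | add x₁ x₂ h₁ h₂ => simp only [add_mul, mul_add, map_add, h₁, h₂]
      | tmul c d => simp [ht.comm a, ht.comm d.unop]
  eq_zero x hx := by
    classical
    let b := Module.finBasis K A
    refine (TensorProduct.equivFinsuppOfBasisLeft b).map_eq_zero_iff.1 (Finsupp.ext fun i => ?_)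
    rw [TensorProduct.equivFinsuppOfBasisLeft_apply, Finsupp.zero_apply]
    -- Since `c` represents the `i`-th coordinate, pairing `x` with `c ⊗ d` isolates the `i`-th
    -- coefficient of `x` and pairs it with `d`.
    obtain ⟨c, hc⟩ := ht.exists_dual (b.coord i)
    apply unop_injective
    refine ht.eq_zero _ fun d => ?_
    rw [← hx (c ⊗ₜ op d), ht.comm]
    clear hx
    induction x with
    | zero => simp
    | add x₁ x₂ h₁ h₂ => simp only [mul_add, map_add, add_mul, unop_add, h₁, h₂]
    | tmul y z => simp [← hc, ht.comm c]

end Enveloping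

end IsSymmetrizingForm

section Character

variable {K A : Type*} [Field K] [Ring A] [Algebra K A]

/-- The character `a ⊗ b ↦ χ₁ a * χ₂ b` of the enveloping algebra. -/
def envelopingCharacter (χ₁ χ₂ : A →ₐ[K] K) : A ⊗[K] Aᵐᵒᵖ →ₐ[K] K :=
  Algebra.TensorProduct.productMap χ₁ (χ₂.fromOpposite fun _ _ => Commute.all _ _)

@[simp]
theorem envelopingCharacter_tmul (χ₁ χ₂ : A →ₐ[K] K) (a : A) (b : Aᵐᵒᵖ) :
    envelopingCharacter χ₁ χ₂ (a ⊗ₜ b) = χ₁ a * χ₂ b.unop := by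
  simp [envelopingCharacter]

/-- Identifies `s₁ ⊗ op s₂` as the socle element of the product character, so that the results for
one character apply to bimodules. -/
theorem enveloping_mul_tmul_dual {t : A →ₗ[K] K} {χ₁ χ₂ : A →ₐ[K] K} {s₁ s₂ : A}
    (ht : IsSymmetrizingForm t) (h₁ : ∀ v, t (v * s₁) = χ₁ v) (h₂ : ∀ v, t (v * s₂) = χ₂ v)
    (u : A ⊗[K] Aᵐᵒᵖ) :
    IsSymmetrizingForm.enveloping t (u * (s₁ ⊗ₜ op s₂)) = envelopingCharacter χ₁ χ₂ u := by
  induction u with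
  | zero => simp
  | add x y hx hy => simp only [add_mul, map_add, hx, hy]
  | tmul a b => simp [h₁, ht.comm s₂, h₂]

end Character

/-! ### The duality argument: correcting by elements of `A`, and vanishing of cocycles. -/

section Duality

variable {K A : Type*} [Field K] [Ring A] [Algebra K A]

theorem tmul_eq_right_mul_left (a : A) (b : Aᵐᵒᵖ) :
    (a ⊗ₜ[K] b : A ⊗[K] Aᵐᵒᵖ) = (1 ⊗ₜ b) * (a ⊗ₜ 1) := by
  simp

theorem tmul_eq_left_mul_right (a : A) (b : Aᵐᵒᵖ) :
    (a ⊗ₜ[K] b : A ⊗[K] Aᵐᵒᵖ) = (a ⊗ₜ 1) * (1 ⊗ₜ b) := by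
  simp

variable [Module (A ⊗[K] Aᵐᵒᵖ) A]

/-- Let `A` be a symmetric algebra embedded in a bimodule `P`. An element of `P` on which the
enveloping algebra acts through the character `χ₁ ⊗ χ₂` modulo `A` can be corrected by an element
of `A` so that this holds in `P`, as soon as the one-dimensional modules belonging to `χ₁` and
`χ₂` have no nontrivial extension. -/
theorem exists_sub_smul_eq_character_smul [FiniteDimensional K A]
    (hact : ∀ a b x : A, (a ⊗ₜ[K] op b : A ⊗[K] Aᵐᵒᵖ) • x = a * x * b)
    {t : A →ₗ[K] K} (ht : IsSymmetrizingForm t) {χ₁ χ₂ : A →ₐ[K] K} {s₂ : A}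
    (h₂ : ∀ v, t (v * s₂) = χ₂ v)
    (hExt : ∀ φ : A → K, (∀ a b, χ₁ a = 0 → χ₁ b = 0 → φ (a + b) = φ a + φ b) →
      (∀ r a, χ₁ a = 0 → φ (r * a) = χ₂ r * φ a) → ∃ c : K, ∀ a, χ₁ a = 0 → φ a = c * χ₂ a)
    {P : Type*} [AddCommGroup P] [Module (A ⊗[K] Aᵐᵒᵖ) P] (ι : A →ₗ[A ⊗[K] Aᵐᵒᵖ] P)
    (hι : Function.Injective ι) (y : P)
    (hy : ∀ u, envelopingCharacter χ₁ χ₂ u = 0 → ∃ x, u • y = ι x) :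
    ∃ x : A, ∀ u, u • (y - ι x) =
      algebraMap K (A ⊗[K] Aᵐᵒᵖ) (envelopingCharacter χ₁ χ₂ u) • (y - ι x) := by
  have hl : ∀ a x : A, (a ⊗ₜ[K] 1 : A ⊗[K] Aᵐᵒᵖ) • ι x = ι (a * x) := fun a x => by
    rw [← map_smul, ← op_one, hact, mul_one]
  have hr : ∀ b x : A, (1 ⊗ₜ[K] op b : A ⊗[K] Aᵐᵒᵖ) • ι x = ι (x * b) := fun b x => by
    rw [← map_smul, hact, one_mul]
  -- correction making the right action of the kernel of `χ₂` trivial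
  have hμ : ∀ b : A, ∃ m, (1 ⊗ₜ[K] op (b - algebraMap K A (χ₂ b)) : A ⊗[K] Aᵐᵒᵖ) • y = ι m :=
    fun b => hy _ (by simp)
  choose μ hμ using hμ
  let f : A →ₗ[K] K :=
    { toFun := fun b => t (μ b)
      map_add' := fun b b' => by
        rw [← map_add]
        congr 1
        apply hι
        rw [map_add, ← hμ, ← hμ, ← hμ, ← add_smul, ← TensorProduct.tmul_add, ← op_add]
        congr 3
        simp only [map_add]
        abel
      map_smul' := fun c b => by
        rw [RingHom.id_apply, ← map_smul]
        congr 1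
        apply hι
        rw [Algebra.smul_def c (μ b), ← hl, ← hμ, ← hμ, smul_smul]
        congr 1
        simp only [Algebra.TensorProduct.tmul_mul_tmul, mul_one, one_mul]
        rw [Algebra.algebraMap_eq_smul_one c, TensorProduct.smul_tmul]
        congr 1
        simp [smul_sub, Algebra.algebraMap_eq_smul_one, mul_smul] }
  -- Self-injectivity made explicit: on the kernel of `χ₂` the map `μ` is right linear, hence
  -- determined by `t ∘ μ`, and is left multiplication by the element `c` representing that form.
  obtain ⟨c, hc⟩ := ht.exists_dual f
  have hc' : ∀ b, χ₂ b = 0 → (1 ⊗ₜ[K] op b : A ⊗[K] Aᵐᵒᵖ) • y = ι (c * b) := by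
    intro b hb
    have h0 : ∀ b, χ₂ b = 0 → (1 ⊗ₜ[K] op b : A ⊗[K] Aᵐᵒᵖ) • y = ι (μ b) := fun b hb => by
      rw [← hμ, hb, map_zero, sub_zero]
    rw [h0 b hb]
    congr 1
    refine ht.ext fun a => ?_
    have : μ (b * a) = μ b * a := hι <| by
      rw [← h0 _ (by simp [hb]), ← hr, ← h0 _ hb, smul_smul]
      simp
    rw [ht.comm, ← this, ← mul_assoc, ht.comm, ← mul_assoc, hc]
    rfl
  set y₁ := y - ι c with hy₁
  have hr₁ : ∀ b, χ₂ b = 0 → (1 ⊗ₜ[K] op b : A ⊗[K] Aᵐᵒᵖ) • y₁ = 0 := fun b hb => by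
    rw [hy₁, smul_sub, hc' b hb, hr, sub_self]
  -- correction making the left action of the kernel of `χ₁` trivial
  have hlam : ∀ a : A, ∃ m, χ₁ a = 0 → (a ⊗ₜ[K] 1 : A ⊗[K] Aᵐᵒᵖ) • y₁ = ι m := fun a => by
    by_cases ha : χ₁ a = 0
    · obtain ⟨m, hm⟩ := hy (a ⊗ₜ 1) (by simp [ha])
      exact ⟨m - a * c, fun _ => by rw [hy₁, smul_sub, hm, hl, map_sub]⟩
    · exact ⟨0, fun h => (ha h).elim⟩
  choose l hlam using hlam
  -- The two actions commute, so `l a` is still killed on the right by the kernel of `χ₂` and lies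
  -- on the line of `s₂`. The remaining obstruction is the scalar function `t ∘ l`, to which `hExt`
  -- applies.
  have hls : ∀ a, χ₁ a = 0 → l a = t (l a) • s₂ := fun a ha => by
    refine ht.eq_smul_dual' h₂ fun u => ?_
    have : l a * (u - algebraMap K A (χ₂ u)) = 0 := hι <| by
      rw [← hr, ← hlam a ha, smul_smul, ← tmul_eq_right_mul_left, tmul_eq_left_mul_right,
        mul_smul, hr₁ _ (by simp), smul_zero, map_zero]
    rw [mul_sub, sub_eq_zero] at this
    rw [this, ← Algebra.commutes, Algebra.smul_def]
  obtain ⟨d, hd⟩ := hExt (fun a => t (l a))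
    (fun a b ha hb => by
      rw [← map_add]
      congr 1
      apply hι
      rw [map_add, ← hlam _ ha, ← hlam _ hb, ← hlam _ (by simp [ha, hb]), TensorProduct.add_tmul,
        add_smul])
    (fun r a ha => by
      have : l (r * a) = r * l a := hι <| by
        rw [← hl, ← hlam _ ha, ← hlam _ (by simp [ha]), smul_smul]
        simp
      rw [this, hls a ha, mul_smul_comm, map_smul, map_smul, h₂,
        IsSymmetrizingForm.apply_dual h₂, smul_eq_mul, smul_eq_mul, mul_one, mul_comm])
  -- The second correction preserves the first, because the kernel of `χ₂` kills `s₂` on the right.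
  refine ⟨c + d • s₂, ?_⟩
  have hy₂ : y - ι (c + d • s₂) = y₁ - ι (d • s₂) := by rw [map_add, hy₁, sub_sub]
  rw [hy₂]
  have hl₂ : ∀ a, χ₁ a = 0 → (a ⊗ₜ[K] 1 : A ⊗[K] Aᵐᵒᵖ) • (y₁ - ι (d • s₂)) = 0 := fun a ha => by
    rw [smul_sub, hlam a ha, hl, ← map_sub, hls a ha, hd a ha, mul_smul_comm, ht.mul_dual h₂,
      smul_smul, sub_self, map_zero]
  have hr₂ : ∀ b, χ₂ b = 0 → (1 ⊗ₜ[K] op b : A ⊗[K] Aᵐᵒᵖ) • (y₁ - ι (d • s₂)) = 0 := fun b hb => by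
    rw [smul_sub, hr₁ b hb, hr, smul_mul_assoc, ht.dual_mul h₂, hb, zero_smul, smul_zero, map_zero,
      sub_zero]
  generalize y₁ - ι (d • s₂) = z at hl₂ hr₂ ⊢
  have hl₃ : ∀ a, (a ⊗ₜ[K] 1 : A ⊗[K] Aᵐᵒᵖ) • z = algebraMap K (A ⊗[K] Aᵐᵒᵖ) (χ₁ a) • z :=
    fun a => by
      have := hl₂ (a - algebraMap K A (χ₁ a)) (by simp)
      rwa [TensorProduct.sub_tmul, sub_smul, sub_eq_zero] at this
  have hr₃ : ∀ b, (1 ⊗ₜ[K] op b : A ⊗[K] Aᵐᵒᵖ) • z = algebraMap K (A ⊗[K] Aᵐᵒᵖ) (χ₂ b) • z :=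
    fun b => by
      have := hr₂ (b - algebraMap K A (χ₂ b)) (by simp)
      rw [op_sub, TensorProduct.tmul_sub, sub_smul, sub_eq_zero] at this
      rw [this, Algebra.algebraMap_eq_smul_one (χ₂ b), op_smul, TensorProduct.tmul_smul, op_one,
        Algebra.algebraMap_eq_smul_one, Algebra.TensorProduct.one_def]
  intro u
  induction u with
  | zero => simp
  | add u v hu hv => rw [add_smul, hu, hv, map_add, map_add, add_smul]
  | tmul a b =>
    rw [tmul_eq_left_mul_right, mul_smul, ← op_unop b, hr₃, smul_smul, ← Algebra.commutes,
      mul_smul, hl₃, smul_smul, ← map_mul]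
    simp [mul_comm]

/-- Let `0 → A → P₃ → P₂ → P₁` be exact with `P₃` and `P₂` projective bimodules over the symmetric
algebra `A`. If the one-dimensional modules belonging to `χ₁` and `χ₂` have no nontrivial
extension, then every `χ₁ ⊗ χ₂`-semilinear form on `P₂` vanishing on boundaries vanishes on each
`p` with `d₂ (s • p) = 0`, where `s` is the socle element of the enveloping algebra belonging to
`χ₁ ⊗ χ₂`. -/
theorem cocycle_apply_eq_zero [FiniteDimensional K A]
    (hact : ∀ a b x : A, (a ⊗ₜ[K] op b : A ⊗[K] Aᵐᵒᵖ) • x = a * x * b)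
    {t : A →ₗ[K] K} (ht : IsSymmetrizingForm t) {χ₁ χ₂ : A →ₐ[K] K} {s₁ s₂ : A}
    (h₁ : ∀ v, t (v * s₁) = χ₁ v) (h₂ : ∀ v, t (v * s₂) = χ₂ v)
    (hExt : ∀ φ : A → K, (∀ a b, χ₁ a = 0 → χ₁ b = 0 → φ (a + b) = φ a + φ b) →
      (∀ r a, χ₁ a = 0 → φ (r * a) = χ₂ r * φ a) → ∃ c : K, ∀ a, χ₁ a = 0 → φ a = c * χ₂ a)
    {P₁ P₂ P₃ : Type*} [AddCommGroup P₁] [AddCommGroup P₂] [AddCommGroup P₃]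
    [Module (A ⊗[K] Aᵐᵒᵖ) P₁] [Module (A ⊗[K] Aᵐᵒᵖ) P₂] [Module (A ⊗[K] Aᵐᵒᵖ) P₃]
    [Module.Projective (A ⊗[K] Aᵐᵒᵖ) P₂] [Module.Projective (A ⊗[K] Aᵐᵒᵖ) P₃]
    (ι : A →ₗ[A ⊗[K] Aᵐᵒᵖ] P₃) (d₃ : P₃ →ₗ[A ⊗[K] Aᵐᵒᵖ] P₂) (d₂ : P₂ →ₗ[A ⊗[K] Aᵐᵒᵖ] P₁)
    (hι : Function.Injective ι) (hex₃ : Function.Exact ι d₃) (hex₂ : Function.Exact d₃ d₂)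
    (Θ : P₂ →ₛₗ[(envelopingCharacter χ₁ χ₂ : A ⊗[K] Aᵐᵒᵖ →+* K)] K) (hΘ : ∀ w, Θ (d₃ w) = 0)
    {p : P₂} (hp : (s₁ ⊗ₜ[K] op s₂ : A ⊗[K] Aᵐᵒᵖ) • d₂ p = 0) : Θ p = 0 := by
  have hT := ht.isSymmetrizingForm_enveloping
  have hs := enveloping_mul_tmul_dual ht h₁ h₂
  obtain ⟨y, hy⟩ := (hex₂ ((s₁ ⊗ₜ[K] op s₂ : A ⊗[K] Aᵐᵒᵖ) • p)).1 (by rw [map_smul, hp])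
  -- The boundary of `y` is a multiple of the socle element, so the kernel of the character moves
  -- `y` into the kernel of `d₃`, which is the image of `ι`.
  obtain ⟨x, hx⟩ := exists_sub_smul_eq_character_smul hact ht h₂ hExt ι hι y fun u hu => by
    obtain ⟨x, hx⟩ := (hex₃ (u • y)).1 (by
      rw [map_smul, hy, smul_smul, hT.mul_dual hs, hu, zero_smul]
      exact zero_smul (A ⊗[K] Aᵐᵒᵖ) p)
    exact ⟨x, hx.symm⟩
  obtain ⟨w, hw⟩ := hT.exists_eq_dual_smul hs hx
  have hyw : d₃ y = (s₁ ⊗ₜ[K] op s₂ : A ⊗[K] Aᵐᵒᵖ) • d₃ w := by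
    rw [← map_smul, ← hw, map_sub, (hex₃ (ι x)).2 ⟨x, rfl⟩, sub_zero]
  -- The socle element kills `p - d₃ w`, so `Θ` cannot distinguish `p` from a boundary.
  have := hT.apply_eq_zero_of_dual_smul hs Θ (p := p - d₃ w) (by rw [smul_sub, ← hyw, hy, sub_self])
  rwa [map_sub, hΘ, sub_zero] at this

end Duality

/-! ### Path coefficients, the length filtration and vertex characters. -/

namespace PathAlgebra

section Coefficients

variable {K : Type u} {V : Type v} [Field K] [Quiver.{w} V]

/-- The coefficient of a path, as a linear form on the path algebra. -/
def coeffHom (K : Type u) [Field K] {a b : V} (p : Quiver.Path a b) : PathAlgebra K V →ₗ[K] K :=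
  (Finsupp.lapply (⟨a, b, p⟩ : QuiverPath V) : (QuiverPath V →₀ K) →ₗ[K] K)

open Classical in
theorem coeffHom_ofPath {a b c d : V} (p : Quiver.Path a b) (q : Quiver.Path c d) :
    coeffHom K p (ofPath K q) =
      if (⟨c, d, q⟩ : QuiverPath V) = ⟨a, b, p⟩ then 1 else 0 :=
  Finsupp.single_apply

@[simp]
theorem coeffHom_ofPath_self {a b : V} (p : Quiver.Path a b) :
    coeffHom K p (ofPath K p) = 1 := by
  rw [coeffHom_ofPath, if_pos rfl]

theorem coeffHom_ofPath_of_ne {a b c d : V} {p : Quiver.Path a b} {q : Quiver.Path c d}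
    (h : (⟨c, d, q⟩ : QuiverPath V) ≠ ⟨a, b, p⟩) : coeffHom K p (ofPath K q) = 0 := by
  rw [coeffHom_ofPath, if_neg h]

theorem coeffHom_ofPath_of_length_ne {a b c d : V} {p : Quiver.Path a b} {q : Quiver.Path c d}
    (h : q.length ≠ p.length) : coeffHom K p (ofPath K q) = 0 :=
  coeffHom_ofPath_of_ne fun e => h (congrArg (fun r : QuiverPath V => r.2.2.length) e)

theorem coeffHom_ofPath_of_source_ne {a b c d : V} {p : Quiver.Path a b} {q : Quiver.Path c d}
    (h : c ≠ a) : coeffHom K p (ofPath K q) = 0 :=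
  coeffHom_ofPath_of_ne fun e => h (congrArg (fun r : QuiverPath V => r.1) e)

theorem coeffHom_ofPath_of_target_ne {a b c d : V} {p : Quiver.Path a b} {q : Quiver.Path c d}
    (h : d ≠ b) : coeffHom K p (ofPath K q) = 0 :=
  coeffHom_ofPath_of_ne fun e => h (congrArg (fun r : QuiverPath V => r.2.1) e)

variable (K V) in
/-- The span of the paths of length at least `n`. -/
def lengthGE (n : ℕ) : Submodule K (PathAlgebra K V) :=
  Submodule.span K {x | ∃ (a b : V) (p : Quiver.Path a b), n ≤ p.length ∧ x = ofPath K p}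

theorem ofPath_mem_lengthGE {n : ℕ} {a b : V} {p : Quiver.Path a b} (h : n ≤ p.length) :
    ofPath K p ∈ lengthGE K V n :=
  Submodule.subset_span ⟨a, b, p, h, rfl⟩

theorem coeffHom_eq_zero_of_mem_lengthGE {n : ℕ} {a b : V} {p : Quiver.Path a b}
    (h : p.length < n) {x : PathAlgebra K V} (hx : x ∈ lengthGE K V n) : coeffHom K p x = 0 := by
  refine Submodule.span_le (p := LinearMap.ker (coeffHom K p)).2 ?_ hx
  rintro _ ⟨c, d, q, hq, rfl⟩
  exact coeffHom_ofPath_of_length_ne (by omega)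

theorem mem_lengthGE_zero (x : PathAlgebra K V) : x ∈ lengthGE K V 0 := by
  induction x using induction_on with
  | zero => exact zero_mem _
  | add y z hy hz => exact add_mem hy hz
  | smul_path r a b p => exact Submodule.smul_mem _ r (ofPath_mem_lengthGE (Nat.zero_le _))

theorem ofPath_mul_ofPath {a b c : V} (p : Quiver.Path a b) (q : Quiver.Path b c) :
    ofPath K p * ofPath K q = ofPath K (p.comp q) :=
  (mulHom_ofPath K p q).trans (pathMul_comp K p q)

theorem ofPath_mul_ofPath_of_ne {a b c d : V} (p : Quiver.Path a b) (q : Quiver.Path c d)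
    (h : b ≠ c) : ofPath K p * ofPath K q = 0 :=
  (mulHom_ofPath K p q).trans (pathMul_of_ne K p q h)

theorem ofPath_cons {a b c : V} (p : Quiver.Path a b) (α : b ⟶ c) :
    ofPath K (p.cons α) = ofPath K p * ofPath K α.toPath := by
  rw [ofPath_mul_ofPath]; rfl

end Coefficients

section Algebra

variable {K : Type u} {V : Type v} [Field K] [Quiver.{w} V] [Fintype V]

theorem one_eq_sum_ofPath_nil :
    (1 : PathAlgebra K V) = ∑ a : V, ofPath K (Quiver.Path.nil : Quiver.Path a a) := rfl

theorem mul_mem_lengthGE {m n : ℕ} {x y : PathAlgebra K V} (hx : x ∈ lengthGE K V m)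
    (hy : y ∈ lengthGE K V n) : x * y ∈ lengthGE K V (m + n) := by
  induction hx using Submodule.span_induction with
  | zero => rw [zero_mul]; exact zero_mem _
  | add x₁ x₂ _ _ h₁ h₂ => rw [add_mul]; exact add_mem h₁ h₂
  | smul r x _ h => rw [smul_mul_assoc]; exact Submodule.smul_mem _ r h
  | mem x hx =>
    obtain ⟨a, b, p, hp, rfl⟩ := hx
    induction hy using Submodule.span_induction with
    | zero => rw [mul_zero]; exact zero_mem _
    | add x₁ x₂ _ _ h₁ h₂ => rw [mul_add]; exact add_mem h₁ h₂
    | smul r x _ h => rw [mul_smul_comm]; exact Submodule.smul_mem _ r h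
    | mem y hy =>
      obtain ⟨c, d, q, hq, rfl⟩ := hy
      by_cases h : b = c
      · subst h
        rw [ofPath_mul_ofPath]
        exact ofPath_mem_lengthGE (by rw [Quiver.Path.length_comp]; omega)
      · rw [ofPath_mul_ofPath_of_ne _ _ h]
        exact zero_mem _

/-- The span of the paths of length at least `n`, as a left ideal. -/
def lengthIdeal (K : Type u) (V : Type v) [Field K] [Quiver.{w} V] [Fintype V] (n : ℕ) :
    Ideal (PathAlgebra K V) where
  __ := (lengthGE K V n).toAddSubmonoid
  smul_mem' r x hx := by simpa using mul_mem_lengthGE (mem_lengthGE_zero r) hx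

theorem mem_lengthIdeal {n : ℕ} {x : PathAlgebra K V} :
    x ∈ lengthIdeal K V n ↔ x ∈ lengthGE K V n := Iff.rfl

theorem arrowIdeal_le_lengthIdeal : arrowIdeal K V ≤ lengthIdeal K V 1 := by
  intro x hx
  let J : TwoSidedIdeal (PathAlgebra K V) := TwoSidedIdeal.mk' (lengthGE K V 1 : Set _)
    (zero_mem _) add_mem neg_mem
    (fun {x y} hy => by simpa using mul_mem_lengthGE (mem_lengthGE_zero x) hy)
    (fun {x y} hx => by simpa using mul_mem_lengthGE hx (mem_lengthGE_zero y))
  have h : TwoSidedIdeal.span {x : PathAlgebra K V | ∃ (a b : V) (α : a ⟶ b),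
      x = ofPath K α.toPath} ≤ J := by
    rw [TwoSidedIdeal.span_le]
    rintro _ ⟨a, b, α, rfl⟩
    rw [SetLike.mem_coe, TwoSidedIdeal.mem_mk']
    exact ofPath_mem_lengthGE (le_of_eq (Quiver.Path.length_toPath α).symm)
  have := h (TwoSidedIdeal.mem_asIdeal.1 hx)
  rwa [TwoSidedIdeal.mem_mk'] at this

theorem arrowIdeal_sq_le_lengthIdeal : arrowIdeal K V ^ 2 ≤ lengthIdeal K V 2 := by
  have h : arrowIdeal K V ^ 2 = arrowIdeal K V * arrowIdeal K V := by
    rw [Submodule.pow_succ, Submodule.pow_one]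
  rw [h, Ideal.mul_le]
  intro r hr s hs
  rw [mem_lengthIdeal]
  exact mul_mem_lengthGE (m := 1) (n := 1) (mem_lengthIdeal.1 (arrowIdeal_le_lengthIdeal hr))
    (mem_lengthIdeal.1 (arrowIdeal_le_lengthIdeal hs))

theorem IsAdmissible.mem_lengthGE {I : Ideal (PathAlgebra K V)} (hI : IsAdmissible I)
    {x : PathAlgebra K V} (hx : x ∈ I) : x ∈ lengthGE K V 2 :=
  arrowIdeal_sq_le_lengthIdeal (hI.2.1 hx)

theorem ofPath_mem_arrowIdeal_pow (m : ℕ) {a b : V} (p : Quiver.Path a b) (h : m ≤ p.length) :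
    ofPath K p ∈ arrowIdeal K V ^ m := by
  induction m generalizing b with
  | zero => rw [Submodule.pow_zero, Ideal.one_eq_top]; trivial
  | succ m ih =>
    cases p with
    | nil => simp at h
    | cons p α =>
      rw [ofPath_cons, Submodule.pow_succ]
      refine Ideal.mul_mem_mul (ih p (by simpa using h)) ?_
      exact TwoSidedIdeal.mem_asIdeal.2 (TwoSidedIdeal.subset_span ⟨_, _, α, rfl⟩)

/-- The character of the path algebra given by the coefficient of the trivial path at `l`. -/
def vertexCharacter (K : Type u) {V : Type v} [Field K] [Quiver.{w} V] [Fintype V] (l : V) :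
    PathAlgebra K V →ₐ[K] K :=
  AlgHom.ofLinearMap (coeffHom K (Quiver.Path.nil : Quiver.Path l l))
    (by
      rw [one_eq_sum_ofPath_nil, map_sum, Finset.sum_eq_single l]
      · exact coeffHom_ofPath_self _
      · exact fun b _ hb => coeffHom_ofPath_of_source_ne hb
      · simp)
    (fun x y => by
      induction x using induction_on with
      | zero => simp
      | add x₁ x₂ h₁ h₂ => simp only [add_mul, map_add, h₁, h₂]
      | smul_path r a b p =>
        induction y using induction_on with
        | zero => simp
        | add x₁ x₂ h₁ h₂ => simp only [mul_add, map_add, h₁, h₂]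
        | smul_path s c d q =>
          simp only [smul_mul_assoc, mul_smul_comm, map_smul, smul_eq_mul]
          suffices h : coeffHom K (Quiver.Path.nil : Quiver.Path l l) (ofPath K p * ofPath K q) =
              coeffHom K (Quiver.Path.nil : Quiver.Path l l) (ofPath K p) *
                coeffHom K (Quiver.Path.nil : Quiver.Path l l) (ofPath K q) by
            rw [h]; ring
          by_cases hbc : b = c
          · subst hbc
            rw [ofPath_mul_ofPath]
            cases p with
            | cons p α =>
              rw [coeffHom_ofPath_of_length_ne (q := p.cons α) (by simp), zero_mul]
              exact coeffHom_ofPath_of_length_ne (by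
                rw [Quiver.Path.length_comp, Quiver.Path.length_cons, Quiver.Path.length_nil]
                omega)
            | nil =>
              rw [Quiver.Path.nil_comp]
              by_cases hal : a = l
              · subst hal
                rw [coeffHom_ofPath_self, one_mul]
              · rw [coeffHom_ofPath_of_source_ne hal, coeffHom_ofPath_of_source_ne hal, zero_mul]
          · rw [ofPath_mul_ofPath_of_ne _ _ hbc, map_zero]
            by_cases hbl : b = l
            · rw [coeffHom_ofPath_of_source_ne (q := q) (fun h => hbc (hbl.trans h.symm)),
                mul_zero]
            · rw [coeffHom_ofPath_of_target_ne (q := p) hbl, zero_mul])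

theorem vertexCharacter_apply (l : V) (x : PathAlgebra K V) :
    vertexCharacter K l x = coeffHom K (Quiver.Path.nil : Quiver.Path l l) x := rfl

@[simp]
theorem vertexCharacter_nil_self (l : V) :
    vertexCharacter K l (ofPath K (Quiver.Path.nil : Quiver.Path l l)) = 1 :=
  coeffHom_ofPath_self _

theorem vertexCharacter_nil_of_ne {l m : V} (h : m ≠ l) :
    vertexCharacter K l (ofPath K (Quiver.Path.nil : Quiver.Path m m)) = 0 :=
  coeffHom_ofPath_of_source_ne h

theorem vertexCharacter_of_length_ne_zero (l : V) {a b : V} {p : Quiver.Path a b}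
    (h : p.length ≠ 0) : vertexCharacter K l (ofPath K p) = 0 :=
  coeffHom_ofPath_of_length_ne h

theorem vertexCharacter_eq_zero_of_mem_lengthGE (l : V) {n : ℕ} (hn : 0 < n)
    {x : PathAlgebra K V} (hx : x ∈ lengthGE K V n) : vertexCharacter K l x = 0 :=
  coeffHom_eq_zero_of_mem_lengthGE (p := (Quiver.Path.nil : Quiver.Path l l)) hn hx

/-- A factor of positive length pushes every term beyond the length of `γ`, so only the trivial path
at the source of `γ` contributes. With its right-hand analogue this makes the coefficient at `γ` a
bimodule map from `I` to a one-dimensional bimodule when `γ` has length two. -/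
theorem coeffHom_mul_of_mem_lengthGE {a b : V} (γ : Quiver.Path a b) (x : PathAlgebra K V)
    {w : PathAlgebra K V} (hw : w ∈ lengthGE K V γ.length) :
    coeffHom K γ (x * w) = vertexCharacter K a x * coeffHom K γ w := by
  induction hw using Submodule.span_induction with
  | zero => simp
  | add x₁ x₂ _ _ h₁ h₂ => rw [mul_add, map_add, h₁, h₂, map_add, mul_add]
  | smul r y _ h => rw [mul_smul_comm, map_smul, h, map_smul, mul_smul_comm]
  | mem w hw =>
    obtain ⟨c, d, q, hq, rfl⟩ := hw
    induction x using induction_on with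
    | zero => simp
    | add x₁ x₂ h₁ h₂ => rw [add_mul, map_add, h₁, h₂, map_add, add_mul]
    | smul_path r a' b' p =>
      rw [smul_mul_assoc, map_smul, map_smul, smul_mul_assoc]
      congr 1
      by_cases hbc : b' = c
      · subst hbc
        rw [ofPath_mul_ofPath]
        cases p with
        | cons p α =>
          rw [vertexCharacter_of_length_ne_zero a (by simp), zero_mul]
          exact coeffHom_ofPath_of_length_ne (by
            rw [Quiver.Path.length_comp, Quiver.Path.length_cons]; omega)
        | nil =>
          rw [Quiver.Path.nil_comp]
          by_cases hal : a' = a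
          · subst hal
            rw [vertexCharacter_nil_self, one_mul]
          · rw [coeffHom_ofPath_of_source_ne hal, mul_zero]
      · rw [ofPath_mul_ofPath_of_ne _ _ hbc, map_zero, vertexCharacter_apply]
        by_cases hbl : b' = a
        · rw [coeffHom_ofPath_of_source_ne (q := q) (fun h => hbc (hbl.trans h.symm)), mul_zero]
        · rw [coeffHom_ofPath_of_target_ne (q := p) hbl, zero_mul]

theorem coeffHom_mul_of_mem_lengthGE' {a b : V} (γ : Quiver.Path a b) (x : PathAlgebra K V)
    {w : PathAlgebra K V} (hw : w ∈ lengthGE K V γ.length) :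
    coeffHom K γ (w * x) = coeffHom K γ w * vertexCharacter K b x := by
  induction hw using Submodule.span_induction with
  | zero => simp
  | add x₁ x₂ _ _ h₁ h₂ => rw [add_mul, map_add, h₁, h₂, map_add, add_mul]
  | smul r y _ h => rw [smul_mul_assoc, map_smul, h, map_smul, smul_mul_assoc]
  | mem w hw =>
    obtain ⟨c, d, q, hq, rfl⟩ := hw
    induction x using induction_on with
    | zero => simp
    | add x₁ x₂ h₁ h₂ => rw [mul_add, map_add, h₁, h₂, map_add, mul_add]
    | smul_path r a' b' p =>
      rw [mul_smul_comm, map_smul, map_smul, mul_smul_comm]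
      congr 1
      by_cases hbc : d = a'
      · subst hbc
        rw [ofPath_mul_ofPath]
        cases p with
        | cons p α =>
          rw [vertexCharacter_of_length_ne_zero b (by simp), mul_zero]
          exact coeffHom_ofPath_of_length_ne (by
            rw [Quiver.Path.length_comp, Quiver.Path.length_cons]; omega)
        | nil =>
          rw [Quiver.Path.comp_nil]
          by_cases hal : d = b
          · subst hal
            rw [vertexCharacter_nil_self, mul_one]
          · rw [coeffHom_ofPath_of_target_ne hal, zero_mul]
      · rw [ofPath_mul_ofPath_of_ne _ _ hbc, map_zero, vertexCharacter_apply]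
        by_cases hbl : d = b
        · rw [coeffHom_ofPath_of_source_ne (q := p) (fun h => hbc (hbl.trans h.symm)), mul_zero]
        · rw [coeffHom_ofPath_of_target_ne (q := q) hbl, zero_mul]

end Algebra

/-! ### Admissible quotients, and Ext¹ between simples in terms of arrows. -/

section Quotient

variable {K : Type u} {V : Type v} [Field K] [Quiver.{w} V] [Fintype V]

theorem finite_setOf_length_eq [∀ a b : V, Finite (a ⟶ b)] (n : ℕ) :
    {p : QuiverPath V | p.2.2.length = n}.Finite := by
  induction n with
  | zero =>
    refine (Set.finite_range fun a : V => (⟨a, a, Quiver.Path.nil⟩ : QuiverPath V)).subset ?_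
    rintro ⟨a, b, p⟩ hp
    cases p with
    | nil => exact ⟨a, rfl⟩
    | cons p α => simp at hp
  | succ n ih =>
    have := ih.to_subtype
    refine (Set.finite_range fun x : (Σ (p : {p : QuiverPath V | p.2.2.length = n}) (c : V),
      (p.1.2.1 ⟶ c)) => (⟨x.1.1.1, x.2.1, x.1.1.2.2.cons x.2.2⟩ : QuiverPath V)).subset ?_
    rintro ⟨a, b, p⟩ hp
    cases p with
    | nil => simp at hp
    | cons p α => exact ⟨⟨⟨⟨a, _, p⟩, by simpa using hp⟩, _, α⟩, rfl⟩

theorem IsAdmissible.finiteDimensional [∀ a b : V, Finite (a ⟶ b)] {I : Ideal (PathAlgebra K V)}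
    [I.IsTwoSided] (hI : IsAdmissible I) : FiniteDimensional K (PathAlgebra K V ⧸ I) := by
  obtain ⟨-, -, m, -, hm⟩ := hI
  have hfin : {p : QuiverPath V | p.2.2.length < m}.Finite := by
    refine ((Set.finite_lt_nat m).biUnion fun n _ => finite_setOf_length_eq (V := V) n).subset ?_
    intro p hp
    simpa using hp
  refine ⟨Submodule.fg_def.2 ⟨_, hfin.image fun p => Ideal.Quotient.mk I (ofPath K p.2.2), ?_⟩⟩
  refine Submodule.eq_top_iff'.2 fun a => ?_
  obtain ⟨x, rfl⟩ := Ideal.Quotient.mk_surjective a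
  rw [← Ideal.Quotient.mkₐ_eq_mk K]
  induction x using induction_on with
  | zero => rw [map_zero]; exact zero_mem _
  | add y z hy hz => rw [map_add]; exact add_mem hy hz
  | smul_path r a b p =>
    rw [map_smul]
    refine Submodule.smul_mem _ r ?_
    by_cases hp : p.length < m
    · exact Submodule.subset_span ⟨⟨a, b, p⟩, hp, rfl⟩
    · rw [Ideal.Quotient.mkₐ_eq_mk, Ideal.Quotient.eq_zero_iff_mem.2
        (hm (ofPath_mem_arrowIdeal_pow m p (not_lt.1 hp)))]
      exact zero_mem _

/-- The character of `K Q / I` given by the coefficient of the trivial path at `l`. -/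
def quotientCharacter {I : Ideal (PathAlgebra K V)} [I.IsTwoSided] (hI : IsAdmissible I) (l : V) :
    PathAlgebra K V ⧸ I →ₐ[K] K :=
  Ideal.Quotient.liftₐ I (vertexCharacter K l) fun _ hx =>
    vertexCharacter_eq_zero_of_mem_lengthGE l two_pos (hI.mem_lengthGE hx)

@[simp]
theorem quotientCharacter_mk {I : Ideal (PathAlgebra K V)} [I.IsTwoSided] (hI : IsAdmissible I)
    (l : V) (x : PathAlgebra K V) :
    quotientCharacter hI l (Ideal.Quotient.mk I x) = vertexCharacter K l x := rfl

/-- If there is no arrow `k ⟶ i`, then the simple modules at the vertices `i` and `k` have no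
nontrivial extension. -/
theorem exists_eq_mul_quotientCharacter {I : Ideal (PathAlgebra K V)} [I.IsTwoSided]
    (hI : IsAdmissible I) {i k : V} (hik : IsEmpty (k ⟶ i)) (φ : PathAlgebra K V ⧸ I → K)
    (hadd : ∀ a b, quotientCharacter hI i a = 0 → quotientCharacter hI i b = 0 →
      φ (a + b) = φ a + φ b)
    (hmul : ∀ r a, quotientCharacter hI i a = 0 → φ (r * a) = quotientCharacter hI k r * φ a) :
    ∃ c : K, ∀ a, quotientCharacter hI i a = 0 → φ a = c * quotientCharacter hI k a := by
  classical
  let e (l : V) : PathAlgebra K V := ofPath K (Quiver.Path.nil : Quiver.Path l l)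
  -- The constant is `φ (e k)`. If `k = i`, then `χ_k` vanishes on the kernel in question and the
  -- choice of `c` is immaterial.
  obtain ⟨c, hc⟩ : ∃ c : K, k ≠ i → φ (Ideal.Quotient.mk I (e k)) = c := ⟨_, fun _ => rfl⟩
  refine ⟨c, ?_⟩
  -- the difference of the two sides, on the path algebra
  let ψ (x : PathAlgebra K V) : K := φ (Ideal.Quotient.mk I x) - c * vertexCharacter K k x
  have ψadd : ∀ x y, vertexCharacter K i x = 0 → vertexCharacter K i y = 0 →
      ψ (x + y) = ψ x + ψ y := fun x y hx hy => by
    simp only [ψ]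
    rw [map_add, hadd _ _ hx hy, map_add]; ring
  have ψmul : ∀ r x, vertexCharacter K i x = 0 → ψ (r * x) = vertexCharacter K k r * ψ x :=
    fun r x hx => by
    simp only [ψ]
    rw [map_mul, hmul _ _ hx, map_mul, quotientCharacter_mk]; ring
  have ψnil : ∀ l, l ≠ i → ψ (e l) = 0 := fun l hl => by
    by_cases hlk : l = k
    · subst hlk
      simp [ψ, hc hl, e]
    · have h := ψmul (e l) (e l) (vertexCharacter_nil_of_ne hl)
      rwa [ofPath_mul_ofPath, Quiver.Path.nil_comp, vertexCharacter_nil_of_ne hlk, zero_mul] at h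
  -- The absence of arrows `k ⟶ i` enters here: an arrow out of `k` ends at some `b ≠ i`, so `e b`
  -- lies in the kernel and `α = α * e b` can be evaluated by `ψmul`.
  have ψarrow : ∀ {b : V} (α : k ⟶ b), ψ (ofPath K α.toPath) = 0 := fun {b} α => by
    have hb : b ≠ i := fun h => hik.elim (h ▸ α)
    have h := ψmul (ofPath K α.toPath) (e b) (vertexCharacter_nil_of_ne hb)
    rwa [ofPath_mul_ofPath, Quiver.Path.comp_nil, ψnil b hb, mul_zero] at h
  have ψpath : ∀ {a b : V} (p : Quiver.Path a b), vertexCharacter K i (ofPath K p) = 0 →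
      ψ (ofPath K p) = 0 := fun {a b} p hp => by
    cases p with
    | nil =>
      refine ψnil a fun h => ?_
      subst h
      simp at hp
    | cons p α =>
      rw [ofPath_cons, ψmul _ _ (vertexCharacter_of_length_ne_zero i (by simp))]
      by_cases hp0 : p.length = 0
      · cases p with
        | cons => simp at hp0
        | nil =>
          by_cases hak : a = k
          · subst hak
            rw [ψarrow, mul_zero]
          · rw [vertexCharacter_nil_of_ne hak, zero_mul]
      · rw [vertexCharacter_of_length_ne_zero k hp0, zero_mul]
  have ψsmul : ∀ (r : K) x, vertexCharacter K i x = 0 → ψ (r • x) = r * ψ x := fun r x hx => by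
    rw [Algebra.smul_def, ψmul _ _ hx, AlgHom.commutes]; rfl
  have hproj : ∀ x, vertexCharacter K i (x - vertexCharacter K i x • e i) = 0 := fun x => by
    simp [e]
  -- As `ψ` is additive only on the kernel of the character at `i`, the induction runs over the
  -- projection of `x` to that kernel.
  have key : ∀ x, ψ (x - vertexCharacter K i x • e i) = 0 := fun x => by
    induction x using induction_on with
    | zero => simpa using ψsmul 0 0 (map_zero _)
    | add y z hy hz =>
      have : y + z - vertexCharacter K i (y + z) • e i =
          (y - vertexCharacter K i y • e i) + (z - vertexCharacter K i z • e i) := by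
        rw [map_add, add_smul]; abel
      rw [this, ψadd _ _ (hproj y) (hproj z), hy, hz, add_zero]
    | smul_path r a b p =>
      have : r • ofPath K p - vertexCharacter K i (r • ofPath K p) • e i =
          r • (ofPath K p - vertexCharacter K i (ofPath K p) • e i) := by
        rw [map_smul, smul_sub, smul_eq_mul, mul_smul]
      rw [this, ψsmul _ _ (hproj _)]
      by_cases hp : vertexCharacter K i (ofPath K p) = 0
      · rw [hp, zero_smul, sub_zero, ψpath p hp, mul_zero]
      · have hpe : ofPath K p = e i := by
          by_contra hne
          exact hp (coeffHom_ofPath_of_ne fun h => hne (by rw [ofPath, h]; rfl))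
        rw [hpe, vertexCharacter_nil_self, one_smul, sub_self]
        have := ψsmul 0 0 (map_zero _)
        rw [zero_smul, zero_mul] at this
        rw [this, mul_zero]
  intro a ha
  obtain ⟨x, rfl⟩ := Ideal.Quotient.mk_surjective a
  have hx : vertexCharacter K i x = 0 := ha
  have := key x
  rw [hx, zero_smul, sub_zero] at this
  exact sub_eq_zero.1 this

end Quotient

end PathAlgebra

/-! ### Semilinear lifts along a character acting on the right. -/

/-- Lifting semilinear maps from projective modules. -/
theorem Module.Projective.exists_semilinear_lift {E A P X Y : Type*} [Ring E] [Ring A]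
    (ε : E →+* A) [AddCommGroup P] [Module E P] [Module.Projective E P] [AddCommGroup X]
    [Module A X] [AddCommGroup Y] [Module A Y] (f : X →ₗ[A] Y) (g : P →ₛₗ[ε] Y)
    (hg : ∀ p, ∃ x, f x = g p) : ∃ g' : P →ₛₗ[ε] X, ∀ p, f (g' p) = g p := by
  let _ : Module E X := Module.compHom X ε
  let _ : Module E (LinearMap.range f) := Module.compHom _ ε
  let f' : X →ₗ[E] LinearMap.range f :=
    { toFun := f.rangeRestrict
      map_add' := map_add _
      map_smul' := fun u x => map_smul f.rangeRestrict (ε u) x }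
  let g₁ : P →ₗ[E] LinearMap.range f :=
    { toFun := fun p => ⟨g p, hg p⟩
      map_add' := fun p q => Subtype.ext (map_add g p q)
      map_smul' := fun u p => Subtype.ext (map_smulₛₗ g u p) }
  obtain ⟨g', hg'⟩ := Module.projective_lifting_property f' g₁ f.surjective_rangeRestrict
  exact ⟨{ toFun := g', map_add' := map_add g', map_smul' := fun u p => map_smul g' u p },
    fun p => congrArg Subtype.val (LinearMap.congr_fun hg' p)⟩

section RightCharacter

variable {K A : Type*} [Field K] [Ring A] [Algebra K A]

/-- The homomorphism `a ⊗ b ↦ χ b • a` from the enveloping algebra of `A` to `A`, through which a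
left `A`-module becomes a bimodule on which `A` acts from the right by the character `χ`. -/
def rightCharacter (χ : A →ₐ[K] K) : A ⊗[K] Aᵐᵒᵖ →ₐ[K] A :=
  Algebra.TensorProduct.lift (AlgHom.id K A)
    ((Algebra.ofId K A).comp (χ.fromOpposite fun _ _ => Commute.all _ _))
    fun a b => (Algebra.commutes (χ b.unop) a).symm

@[simp]
theorem rightCharacter_tmul (χ : A →ₐ[K] K) (a : A) (b : Aᵐᵒᵖ) :
    rightCharacter χ (a ⊗ₜ b) = χ b.unop • a := by
  rw [Algebra.smul_def, Algebra.commutes]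
  rfl

theorem apply_rightCharacter (χ₁ χ₂ : A →ₐ[K] K) (u : A ⊗[K] Aᵐᵒᵖ) :
    χ₁ (rightCharacter χ₂ u) = envelopingCharacter χ₁ χ₂ u := by
  induction u with
  | zero => simp
  | add x y hx hy => rw [map_add, map_add, hx, hy, map_add]
  | tmul a b => simp [mul_comm]

theorem apply_smul_eq [Module (A ⊗[K] Aᵐᵒᵖ) A]
    (hact : ∀ a b x : A, (a ⊗ₜ[K] op b : A ⊗[K] Aᵐᵒᵖ) • x = a * x * b) (χ : A →ₐ[K] K)
    (u : A ⊗[K] Aᵐᵒᵖ) (x : A) : χ (u • x) = χ (rightCharacter χ u) * χ x := by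
  induction u with
  | zero =>
    rw [map_zero, map_zero, zero_mul]
    exact (congrArg χ (zero_smul (A ⊗[K] Aᵐᵒᵖ) x)).trans (map_zero χ)
  | add u v hu hv => rw [add_smul, map_add, hu, hv, map_add, map_add, add_mul]
  | tmul a b =>
    rw [← op_unop b, hact]
    simp
    ring

/-- A bimodule map onto `A` lifts a character of `A` to a map into `A`. -/
theorem exists_character_lift [Module (A ⊗[K] Aᵐᵒᵖ) A]
    (hact : ∀ a b x : A, (a ⊗ₜ[K] op b : A ⊗[K] Aᵐᵒᵖ) • x = a * x * b) (χ : A →ₐ[K] K)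
    {P : Type*} [AddCommGroup P] [Module (A ⊗[K] Aᵐᵒᵖ) P]
    [Module.Projective (A ⊗[K] Aᵐᵒᵖ) P] (π : P →ₗ[A ⊗[K] Aᵐᵒᵖ] A) :
    ∃ g : P →ₛₗ[(rightCharacter χ : A ⊗[K] Aᵐᵒᵖ →+* A)] A, ∀ p, χ (g p) = χ (π p) := by
  -- Modulo the kernel of `χ`, right multiplication by `b` on `A` is multiplication by `χ b`, which
  -- makes `π` semilinear.
  let g₁ : P →ₛₗ[(rightCharacter χ : A ⊗[K] Aᵐᵒᵖ →+* A)] A ⧸ RingHom.ker χ :=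
    { toFun := fun p => Submodule.Quotient.mk (π p)
      map_add' := fun p q => by rw [map_add]; rfl
      map_smul' := fun u p => by
        rw [map_smul, ← Submodule.Quotient.mk_smul, Submodule.Quotient.eq, RingHom.mem_ker,
          map_sub, apply_smul_eq hact, smul_eq_mul, map_mul]
        exact sub_self _ }
  obtain ⟨g, hg⟩ := Module.Projective.exists_semilinear_lift _ (RingHom.ker χ).mkQ g₁
    fun p => ⟨π p, rfl⟩
  refine ⟨g, fun p => ?_⟩
  have := (Submodule.Quotient.eq _).1 (hg p)
  rwa [RingHom.mem_ker, map_sub, sub_eq_zero] at this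

theorem rightCharacter_map_left_smul {χ : A →ₐ[K] K} {P X : Type*} [AddCommGroup P]
    [Module (A ⊗[K] Aᵐᵒᵖ) P] [AddCommGroup X] [Module A X]
    (g : P →ₛₗ[(rightCharacter χ : A ⊗[K] Aᵐᵒᵖ →+* A)] X) (a : A) (y : P) :
    g ((a ⊗ₜ[K] 1 : A ⊗[K] Aᵐᵒᵖ) • y) = a • g y := by
  rw [map_smulₛₗ]
  change rightCharacter χ _ • _ = _
  rw [rightCharacter_tmul, unop_one, map_one, one_smul]

theorem rightCharacter_map_right_smul {χ : A →ₐ[K] K} {P X : Type*} [AddCommGroup P]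
    [Module (A ⊗[K] Aᵐᵒᵖ) P] [AddCommGroup X] [Module A X]
    (g : P →ₛₗ[(rightCharacter χ : A ⊗[K] Aᵐᵒᵖ →+* A)] X) {b : A} (hb : χ b = 0) (y : P) :
    g ((1 ⊗ₜ[K] op b : A ⊗[K] Aᵐᵒᵖ) • y) = 0 := by
  rw [map_smulₛₗ]
  change rightCharacter χ _ • _ = _
  rw [rightCharacter_tmul, unop_op, hb, zero_smul, zero_smul]

end RightCharacter

/-! ### The Ext² class attached to a path of length two. -/

namespace PathAlgebra

variable {K : Type u} {V : Type v} [Field K] [Quiver.{w} V] [Fintype V]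

/-- The elements of `I` in which the path `γ` does not occur, inside the kernel of the character
at the end point of `γ`. -/
def relationsWithout {I : Ideal (PathAlgebra K V)} (hI : IsAdmissible I) {i k : V}
    (γ : Quiver.Path i k) (hγ : γ.length = 2) :
    Submodule (PathAlgebra K V) (RingHom.ker (vertexCharacter K k)) where
  carrier := {m | m.1 ∈ I ∧ coeffHom K γ m.1 = 0}
  zero_mem' := ⟨zero_mem I, map_zero _⟩
  add_mem' := fun {x y} hx hy => ⟨add_mem hx.1 hy.1, by
    rw [Submodule.coe_add, map_add, hx.2, hy.2, add_zero]⟩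
  smul_mem' := fun r x hx => ⟨I.mul_mem_left r hx.1, by
    rw [Submodule.coe_smul, smul_eq_mul,
      coeffHom_mul_of_mem_lengthGE γ r (hγ ▸ hI.mem_lengthGE hx.1), hx.2, mul_zero]⟩

/-- The extension of the kernel of the character at the end point of `γ`, as a left module over
`K Q / I`, by the simple module at the starting point of `γ`, in which the relations are evaluated
by their coefficient at `γ`. -/
theorem exists_extension {I : Ideal (PathAlgebra K V)} [I.IsTwoSided] (hI : IsAdmissible I)
    {i k : V} (γ : Quiver.Path i k) (hγ : γ.length = 2) :
    ∃ (F : Type (max u v w)) (_ : AddCommGroup F) (_ : Module (PathAlgebra K V ⧸ I) F)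
      (f : F →ₗ[PathAlgebra K V ⧸ I] PathAlgebra K V ⧸ I)
      (q : RingHom.ker (vertexCharacter K k) →+ F) (c : F →+ K),
      (∀ m, f (q m) = Ideal.Quotient.mk I m.1) ∧
      (∀ x m, Ideal.Quotient.mk I x • q m = q (x • m)) ∧
      (∀ m, c (q m) = coeffHom K γ m.1) ∧
      (∀ (r : K) n, c (algebraMap K (PathAlgebra K V ⧸ I) r • n) = r * c n) ∧
      (∀ a n, f n = 0 → c (a • n) = quotientCharacter hI i a * c n) := by
  let W := relationsWithout hI γ hγ
  -- For `x` in `I` and `m` in the kernel of `χ_k`, the coefficient of `x * m` at `γ` carries the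
  -- factor `χ_k m = 0`. This is why the kernel is used instead of the whole path algebra.
  have htor : Module.IsTorsionBySet (PathAlgebra K V)
      (RingHom.ker (vertexCharacter K k) ⧸ W) I := by
    rintro n ⟨x, hx⟩
    obtain ⟨m, rfl⟩ := Submodule.Quotient.mk_surjective _ n
    refine (Submodule.Quotient.mk_eq_zero W (x := x • m)).2 ⟨I.mul_mem_right _ hx, ?_⟩
    rw [Submodule.coe_smul, smul_eq_mul,
      coeffHom_mul_of_mem_lengthGE' γ _ (hγ ▸ hI.mem_lengthGE hx), RingHom.mem_ker.1 m.2, mul_zero]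
  let _ : Module (PathAlgebra K V ⧸ I) (RingHom.ker (vertexCharacter K k) ⧸ W) := htor.module
  let f₀ : (RingHom.ker (vertexCharacter K k) ⧸ W) →ₗ[PathAlgebra K V] PathAlgebra K V ⧸ I :=
    W.mapQ I (RingHom.ker (vertexCharacter K k)).subtype fun m hm => hm.1
  let c : (RingHom.ker (vertexCharacter K k) ⧸ W) →+ K :=
    QuotientAddGroup.lift W.toAddSubgroup
      ((coeffHom K γ).toAddMonoidHom.comp
        (RingHom.ker (vertexCharacter K k)).subtype.toAddMonoidHom) fun m hm => hm.2
  refine ⟨RingHom.ker (vertexCharacter K k) ⧸ W, inferInstance, inferInstance,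
    { toFun := f₀
      map_add' := map_add f₀
      map_smul' := fun a n => by
        obtain ⟨x, rfl⟩ := Ideal.Quotient.mk_surjective a
        exact map_smul f₀ x n }, W.mkQ.toAddMonoidHom, c, fun m => rfl, fun x m => rfl,
    fun m => rfl, ?_, ?_⟩
  · intro r n
    obtain ⟨m, rfl⟩ := Submodule.Quotient.mk_surjective _ n
    change coeffHom K γ (algebraMap K (PathAlgebra K V) r * m.1) = r * coeffHom K γ m.1
    rw [← Algebra.smul_def, map_smul, smul_eq_mul]
  · intro a n hn
    obtain ⟨m, rfl⟩ := Submodule.Quotient.mk_surjective _ n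
    obtain ⟨x, rfl⟩ := Ideal.Quotient.mk_surjective a
    have hm : m.1 ∈ I := Ideal.Quotient.eq_zero_iff_mem.1 hn
    exact coeffHom_mul_of_mem_lengthGE γ x (hγ ▸ hI.mem_lengthGE hm)

/-- The elements of the path algebra supported on paths of length at least two give rise to
chains `z` in `P₁` whose boundary is their commutator with `p₀`, which are killed by the socle
element of the enveloping algebra, and on which the lift `g₁` takes the value given by the
coefficient at `γ`. -/
theorem exists_chain {A : Type*} [Ring A] [Algebra K A] (mk : PathAlgebra K V →ₐ[K] A) {i k : V}
    (γ : Quiver.Path i k) (hγ : γ.length = 2) {χᵢ χₖ : A →ₐ[K] K}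
    (hχᵢ : ∀ x, χᵢ (mk x) = vertexCharacter K i x) (hχₖ : ∀ x, χₖ (mk x) = vertexCharacter K k x)
    {sᵢ sₖ : A} (hsᵢ : ∀ u, sᵢ * u = χᵢ u • sᵢ) (hsₖ : ∀ u, u * sₖ = χₖ u • sₖ)
    {F : Type*} [AddCommGroup F] [Module A F] (f : F →ₗ[A] A)
    (q : RingHom.ker (vertexCharacter K k) →+ F) (c : F →+ K) (hfq : ∀ m, f (q m) = mk m.1)
    (hmq : ∀ x m, mk x • q m = q (x • m)) (hcq : ∀ m, c (q m) = coeffHom K γ m.1)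
    (hcr : ∀ (r : K) n, c (algebraMap K A r • n) = r * c n)
    (hcf : ∀ a n, f n = 0 → c (a • n) = χᵢ a * c n)
    {P₀ P₁ : Type*} [AddCommGroup P₀] [AddCommGroup P₁] [Module (A ⊗[K] Aᵐᵒᵖ) P₀]
    [Module (A ⊗[K] Aᵐᵒᵖ) P₁] (d₁ : P₁ →ₗ[A ⊗[K] Aᵐᵒᵖ] P₀)
    (g₀ : P₀ →ₛₗ[(rightCharacter χₖ : A ⊗[K] Aᵐᵒᵖ →+* A)] A)
    (g₁ : P₁ →ₛₗ[(rightCharacter χₖ : A ⊗[K] Aᵐᵒᵖ →+* A)] F) (hg₁ : ∀ p, f (g₁ p) = g₀ (d₁ p))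
    {p₀ : P₀} (hboundary : ∀ a : A, ∃ z, d₁ z = (a ⊗ₜ[K] 1 : A ⊗[K] Aᵐᵒᵖ) • p₀ -
      (1 ⊗ₜ[K] op a : A ⊗[K] Aᵐᵒᵖ) • p₀)
    {h : PathAlgebra K V} (hh : mk h = g₀ p₀) (hhk : vertexCharacter K k h = 1)
    {x : PathAlgebra K V} (hx : x ∈ lengthGE K V 2) :
    ∃ z, d₁ z = (mk x ⊗ₜ[K] 1 : A ⊗[K] Aᵐᵒᵖ) • p₀ -
      (1 ⊗ₜ[K] op (mk x) : A ⊗[K] Aᵐᵒᵖ) • p₀ ∧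
      (sᵢ ⊗ₜ[K] op sₖ : A ⊗[K] Aᵐᵒᵖ) • z = 0 ∧ c (g₁ z) = coeffHom K γ x := by
  induction hx using Submodule.span_induction with
  | zero => exact ⟨0, by simp⟩
  | add x y _ _ hx hy =>
    obtain ⟨z, hz, hz', hz''⟩ := hx
    obtain ⟨w, hw, hw', hw''⟩ := hy
    refine ⟨z + w, ?_, ?_, ?_⟩
    · rw [map_add, hz, hw, map_add, TensorProduct.add_tmul, add_smul, op_add,
        TensorProduct.tmul_add, add_smul]
      abel
    · rw [smul_add, hz', hw', add_zero]
    · rw [map_add, map_add, hz'', hw'', map_add]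
  | smul r x _ hx =>
    obtain ⟨z, hz, hz', hz''⟩ := hx
    refine ⟨algebraMap K (A ⊗[K] Aᵐᵒᵖ) r • z, ?_, ?_, ?_⟩
    · rw [map_smul, hz, smul_sub, smul_smul, smul_smul, ← Algebra.smul_def, ← Algebra.smul_def,
        map_smul, op_smul, TensorProduct.tmul_smul, TensorProduct.smul_tmul']
    · rw [smul_smul, ← Algebra.commutes, mul_smul, hz', smul_zero]
    · rw [map_smulₛₗ, map_smul (coeffHom K γ), ← hz'', smul_eq_mul, ← hcr]
      congr 2
      exact (rightCharacter χₖ).commutes r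
  | mem x hx =>
    obtain ⟨a, b, p, hp, rfl⟩ := hx
    cases p with
    | nil => simp at hp
    | cons p β =>
      have hp0 : p.length ≠ 0 := by
        rw [Quiver.Path.length_cons] at hp; omega
      have hβ : χₖ (mk (ofPath K β.toPath)) = 0 :=
        (hχₖ _).trans (vertexCharacter_of_length_ne_zero k (by simp))
      have hp' : χᵢ (mk (ofPath K p)) = 0 :=
        (hχᵢ _).trans (vertexCharacter_of_length_ne_zero i hp0)
      obtain ⟨z, hz⟩ := hboundary (mk (ofPath K p))
      obtain ⟨y, hy⟩ := hboundary (mk (ofPath K β.toPath))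
      -- Leibniz rule for the commutator with `p₀` on the product of `p` and `β`. Both factors have
      -- positive length, so the socle element kills both summands.
      refine ⟨(1 ⊗ₜ[K] op (mk (ofPath K β.toPath)) : A ⊗[K] Aᵐᵒᵖ) • z +
        (mk (ofPath K p) ⊗ₜ[K] 1 : A ⊗[K] Aᵐᵒᵖ) • y, ?_, ?_, ?_⟩
      · rw [map_add, map_smul, map_smul, hz, hy, smul_sub, smul_sub, smul_smul, smul_smul,
          smul_smul, smul_smul]
        simp only [Algebra.TensorProduct.tmul_mul_tmul, one_mul, mul_one, ← op_mul, ← map_mul,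
          ← ofPath_cons]
        abel
      · rw [smul_add, smul_smul, smul_smul]
        simp only [Algebra.TensorProduct.tmul_mul_tmul, mul_one, ← op_mul]
        rw [hsₖ, hβ, hsᵢ, hp', zero_smul, zero_smul, op_zero, TensorProduct.tmul_zero,
          TensorProduct.zero_tmul]
        exact (congrArg₂ (· + ·) (zero_smul (A ⊗[K] Aᵐᵒᵖ) z)
          (zero_smul (A ⊗[K] Aᵐᵒᵖ) y)).trans (add_zero 0)
      · have hmem : ofPath K β.toPath * h ∈ RingHom.ker (vertexCharacter K k) := by
          rw [RingHom.mem_ker, map_mul, vertexCharacter_of_length_ne_zero k (by simp), zero_mul]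
        -- `g₁ y` may be replaced by the explicit lift `q (β * h)`: the difference lies in the
        -- kernel of `f`, and `c` vanishes on `p` times that kernel.
        have hfy : f (g₁ y - q ⟨_, hmem⟩) = 0 := by
          rw [map_sub, hg₁, hfq, hy, map_sub, rightCharacter_map_left_smul,
            rightCharacter_map_right_smul g₀ hβ, sub_zero, smul_eq_mul, map_mul, hh, sub_self]
        have h1 := hcf (mk (ofPath K p)) _ hfy
        rw [hp', zero_mul, smul_sub, map_sub, sub_eq_zero] at h1
        rw [map_add, rightCharacter_map_left_smul, rightCharacter_map_right_smul g₁ hβ, zero_add,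
          h1, hmq, hcq, Submodule.coe_smul, smul_eq_mul, ← mul_assoc, ← ofPath_cons,
          coeffHom_mul_of_mem_lengthGE' γ h (hγ ▸ ofPath_mem_lengthGE hp), hhk, mul_one]

variable {I : Ideal (PathAlgebra K V)} [I.IsTwoSided]
  [Module ((PathAlgebra K V ⧸ I) ⊗[K] (PathAlgebra K V ⧸ I)ᵐᵒᵖ) (PathAlgebra K V ⧸ I)]

/-- Let `0 → Λ → P₃ → P₂ → P₁ → P₀ → Λ → 0` be an exact sequence of bimodules over the symmetric
algebra `Λ = K Q / I`, with all `Pₙ` projective. If a path `γ` of length two from `i` to `k` occurs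
in an element of `I`, then there is an arrow `k ⟶ i`. -/
theorem nonempty_arrow_of_exact [∀ a b : V, Finite (a ⟶ b)] (hI : IsAdmissible I)
    (hact : ∀ a b x : PathAlgebra K V ⧸ I,
      (a ⊗ₜ[K] op b : (PathAlgebra K V ⧸ I) ⊗[K] (PathAlgebra K V ⧸ I)ᵐᵒᵖ) • x = a * x * b)
    {t : PathAlgebra K V ⧸ I →ₗ[K] K} (ht : IsSymmetrizingForm t)
    {P₀ P₁ P₂ P₃ : Type*} [AddCommGroup P₀] [AddCommGroup P₁] [AddCommGroup P₂] [AddCommGroup P₃]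
    [Module ((PathAlgebra K V ⧸ I) ⊗[K] (PathAlgebra K V ⧸ I)ᵐᵒᵖ) P₀]
    [Module ((PathAlgebra K V ⧸ I) ⊗[K] (PathAlgebra K V ⧸ I)ᵐᵒᵖ) P₁]
    [Module ((PathAlgebra K V ⧸ I) ⊗[K] (PathAlgebra K V ⧸ I)ᵐᵒᵖ) P₂]
    [Module ((PathAlgebra K V ⧸ I) ⊗[K] (PathAlgebra K V ⧸ I)ᵐᵒᵖ) P₃]
    [Module.Projective ((PathAlgebra K V ⧸ I) ⊗[K] (PathAlgebra K V ⧸ I)ᵐᵒᵖ) P₀]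
    [Module.Projective ((PathAlgebra K V ⧸ I) ⊗[K] (PathAlgebra K V ⧸ I)ᵐᵒᵖ) P₁]
    [Module.Projective ((PathAlgebra K V ⧸ I) ⊗[K] (PathAlgebra K V ⧸ I)ᵐᵒᵖ) P₂]
    [Module.Projective ((PathAlgebra K V ⧸ I) ⊗[K] (PathAlgebra K V ⧸ I)ᵐᵒᵖ) P₃]
    (ι : (PathAlgebra K V ⧸ I) →ₗ[(PathAlgebra K V ⧸ I) ⊗[K] (PathAlgebra K V ⧸ I)ᵐᵒᵖ] P₃)
    (d₃ : P₃ →ₗ[(PathAlgebra K V ⧸ I) ⊗[K] (PathAlgebra K V ⧸ I)ᵐᵒᵖ] P₂)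
    (d₂ : P₂ →ₗ[(PathAlgebra K V ⧸ I) ⊗[K] (PathAlgebra K V ⧸ I)ᵐᵒᵖ] P₁)
    (d₁ : P₁ →ₗ[(PathAlgebra K V ⧸ I) ⊗[K] (PathAlgebra K V ⧸ I)ᵐᵒᵖ] P₀)
    (π : P₀ →ₗ[(PathAlgebra K V ⧸ I) ⊗[K] (PathAlgebra K V ⧸ I)ᵐᵒᵖ] (PathAlgebra K V ⧸ I))
    (hι : Function.Injective ι) (hex₃ : Function.Exact ι d₃) (hex₂ : Function.Exact d₃ d₂)
    (hex₁ : Function.Exact d₂ d₁) (hex₀ : Function.Exact d₁ π) (hπ : Function.Surjective π)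
    {i k : V} (γ : Quiver.Path i k) (hγ : γ.length = 2) {ρ : PathAlgebra K V} (hρ : ρ ∈ I)
    (hργ : coeffHom K γ ρ ≠ 0) : Nonempty (k ⟶ i) := by
  by_contra hne
  rw [not_nonempty_iff] at hne
  have := hI.finiteDimensional
  let mk : PathAlgebra K V →ₐ[K] PathAlgebra K V ⧸ I := Ideal.Quotient.mkₐ K I
  have hmk : Function.Surjective mk := Ideal.Quotient.mk_surjective
  obtain ⟨sᵢ, hsᵢ⟩ : ∃ s, ∀ v, t (v * s) = quotientCharacter hI i v :=
    ht.exists_dual (quotientCharacter hI i).toLinearMap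
  obtain ⟨sₖ, hsₖ⟩ : ∃ s, ∀ v, t (v * s) = quotientCharacter hI k v :=
    ht.exists_dual (quotientCharacter hI k).toLinearMap
  obtain ⟨F, _, _, f, q, c, hfq, hmq, hcq, hcr, hcf⟩ := exists_extension hI γ hγ
  obtain ⟨p₀, hp₀⟩ := hπ 1
  obtain ⟨g₀, hg₀⟩ := exists_character_lift hact (quotientCharacter hI k) π
  -- Since `π ∘ d₁ = 0`, the map `g₀ ∘ d₁` lands in the kernel of the character at `k`, which is
  -- covered by `f`.
  obtain ⟨g₁, hg₁⟩ := Module.Projective.exists_semilinear_lift _ f (g₀.comp d₁) fun p => by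
    obtain ⟨x, hx⟩ := hmk (g₀ (d₁ p))
    refine ⟨q ⟨x, ?_⟩, (hfq _).trans hx⟩
    rw [RingHom.mem_ker, ← quotientCharacter_mk hI]
    exact (congrArg _ hx).trans (by rw [hg₀, (hex₀ (d₁ p)).2 ⟨p, rfl⟩, map_zero])
  obtain ⟨h, hh⟩ := hmk (g₀ p₀)
  have hhk : vertexCharacter K k h = 1 := by
    rw [← quotientCharacter_mk hI]
    exact (congrArg _ hh).trans (by rw [hg₀, hp₀, map_one])
  obtain ⟨z, hz, hsz, hcz⟩ := exists_chain mk γ hγ (quotientCharacter_mk hI i)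
    (quotientCharacter_mk hI k) (ht.dual_mul hsᵢ) (ht.mul_dual hsₖ) f q c hfq hmq hcq hcr hcf d₁ g₀
    g₁ hg₁ (fun a => (hex₀ _).1 (by
      rw [map_sub, map_smul, map_smul, hp₀, ← op_one, hact, hact, mul_one, one_mul, one_mul,
        mul_one, sub_self])) hh hhk (hI.mem_lengthGE hρ)
  have hρ0 : mk ρ = 0 := Ideal.Quotient.eq_zero_iff_mem.2 hρ
  -- The relation `ρ` vanishes in the quotient, so its chain `z` is a cycle and hence a boundary.
  obtain ⟨p, rfl⟩ := (hex₁ z).1 (by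
    rw [hz, hρ0, op_zero, TensorProduct.tmul_zero, TensorProduct.zero_tmul, sub_self])
  -- The Ext² cocycle: `g₁ ∘ d₂` takes values in the kernel of `f`, where `c` is semilinear along
  -- the character at `i`.
  let Θ : P₂ →ₛₗ[(envelopingCharacter (quotientCharacter hI i) (quotientCharacter hI k) :
      (PathAlgebra K V ⧸ I) ⊗[K] (PathAlgebra K V ⧸ I)ᵐᵒᵖ →+* K)] K :=
    { toFun := fun p => c (g₁ (d₂ p))
      map_add' := fun p p' => by rw [map_add, map_add, map_add]
      map_smul' := fun u p => by
        rw [map_smul, map_smulₛₗ]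
        refine (hcf _ _ ?_).trans ?_
        · rw [hg₁, LinearMap.comp_apply, (hex₁ _).2 ⟨p, rfl⟩, map_zero]
        · exact congrArg (· * _) (apply_rightCharacter _ _ u) }
  refine hργ (hcz.symm.trans ?_)
  exact cocycle_apply_eq_zero hact ht hsᵢ hsₖ
    (fun φ => exists_eq_mul_quotientCharacter hI hne φ) ι d₃ d₂ hι hex₃ hex₂ Θ
    (fun w => by
      change c (g₁ (d₂ (d₃ w))) = 0
      rw [(hex₂ _).2 ⟨w, rfl⟩, map_zero, map_zero]) hsz

end PathAlgebra

/-! ### Splicing the syzygy sequences, and the theorem. -/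

section Syzygy

/-- A syzygy `N` of `M` fits into a short exact sequence `0 → N → P → M → 0` with `P` projective. -/
theorem IsSyzygy.exists_exact {R : Type u} [Ring R] {M N : Type v} [AddCommGroup M] [Module R M]
    [AddCommGroup N] [Module R N] (h : IsSyzygy R M N) :
    ∃ (P : Type v) (_ : AddCommGroup P) (_ : Module R P) (j : N →ₗ[R] P) (π : P →ₗ[R] M),
      Module.Projective R P ∧ Function.Injective j ∧ Function.Exact j π ∧
        Function.Surjective π := by
  obtain ⟨P, _, _, π, ⟨hP, hπ, -⟩, ⟨e⟩⟩ := h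
  refine ⟨P, _, _, (LinearMap.ker π).subtype ∘ₗ e.toLinearMap, π, hP,
    (Submodule.injective_subtype _).comp e.injective, fun x => ⟨fun hx => ?_, ?_⟩, hπ⟩
  · exact ⟨e.symm ⟨x, hx⟩, by simp⟩
  · rintro ⟨n, rfl⟩
    exact (e n).2

theorem Function.Exact.comp_injective_surjective {R : Type*} [Ring R] {A B C D E : Type*}
    [AddCommGroup A] [AddCommGroup B] [AddCommGroup C] [AddCommGroup D] [AddCommGroup E]
    [Module R A] [Module R B] [Module R C] [Module R D] [Module R E]
    {p : A →ₗ[R] B} {j : B →ₗ[R] C} {π : C →ₗ[R] D} {i : D →ₗ[R] E}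
    (h : Function.Exact j π) (hp : Function.Surjective p) (hi : Function.Injective i) :
    Function.Exact (j ∘ₗ p) (i ∘ₗ π) := fun x => by
  rw [LinearMap.comp_apply, map_eq_zero_iff i hi, h x]
  constructor
  · rintro ⟨b, rfl⟩
    obtain ⟨a, rfl⟩ := hp b
    exact ⟨a, rfl⟩
  · rintro ⟨a, rfl⟩
    exact ⟨p a, rfl⟩

end Syzygy

end

theorem proposition4p1 {K : Type u} [Field K] [IsAlgClosed K]
    {V : Type v} [Quiver.{w} V] [Fintype V] [∀ a b : V, Finite (a ⟶ b)]
    (hQ : IsConnectedQuiver V)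
    (I : Ideal (PathAlgebra K V)) [I.IsTwoSided] (hI : PathAlgebra.IsAdmissible I)
    (hsymm : IsSymmetricFDAlgebra K (PathAlgebra K V ⧸ I))
    (hper : IsPeriodicAlgebra K (PathAlgebra K V ⧸ I) 4)
    {i j k : V} (α : i ⟶ j) (β : j ⟶ k)
    (hαβ : PathAlgebra.OccursInMinimalRelation I (α.toPath.comp β.toPath)) :
    Nonempty (k ⟶ i) := by
  let _ : Module ((PathAlgebra K V ⧸ I) ⊗[K] (PathAlgebra K V ⧸ I)ᵐᵒᵖ) (PathAlgebra K V ⧸ I) :=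
    TensorProduct.Algebra.module
  obtain ⟨t, ht⟩ := hsymm.exists_isSymmetrizingForm
  obtain ⟨-, ⟨L₁, _, _, hL₁, L₂, _, _, hL₂, L₃, _, _, hL₃, L₄, _, _, hL₄, ⟨e⟩⟩, -⟩ := hper
  obtain ⟨P₀, _, _, j₀, π₀, _, hj₀, hex₀, hπ₀⟩ := hL₁.exists_exact
  obtain ⟨P₁, _, _, j₁, π₁, _, hj₁, hex₁, hπ₁⟩ := hL₂.exists_exact
  obtain ⟨P₂, _, _, j₂, π₂, _, hj₂, hex₂, hπ₂⟩ := hL₃.exists_exact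
  obtain ⟨P₃, _, _, j₃, π₃, _, hj₃, hex₃, hπ₃⟩ := hL₄.exists_exact
  obtain ⟨ρ, ⟨hρ, -⟩, hc⟩ := hαβ
  exact PathAlgebra.nonempty_arrow_of_exact hI
    (fun a b x => by
      rw [TensorProduct.Algebra.smul_def, op_smul_eq_mul, smul_eq_mul, mul_assoc]) ht
    -- Period 4 supplies `e`, which embeds the algebra itself in `P₃` as the fourth syzygy.
    (j₃ ∘ₗ e.symm.toLinearMap) (j₂ ∘ₗ π₃) (j₁ ∘ₗ π₂) (j₀ ∘ₗ π₁) π₀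
    (hj₃.comp e.symm.injective)
    (hex₃.comp_injective_surjective e.symm.surjective hj₂)
    (hex₂.comp_injective_surjective hπ₃ hj₁) (hex₁.comp_injective_surjective hπ₂ hj₀)
    (hex₀.comp_injective_surjective (i := LinearMap.id) hπ₁ Function.injective_id) hπ₀
    (α.toPath.comp β.toPath) rfl hρ hc
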